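/- **Setting.** Fix $T>0$, $d\in\mathbb N$ and a probability measure $\mathbb P_0$ on the space $D^d$ of càdlàg functions $[0,T]\to\mathbb R^d$ (with the $\sigma$-algebra generated by the coordinate maps). Let $D_\uparrow$ be the space of nondecreasing càdlàg functions $A:[0,T]\to\mathbb R$ with $A_0\ge 0$, and let $(L,A)$ be the coordinate pair on $D^d\times D_\uparrow$. Put $\mathcal F^L_t=\sigma(L_s;s\le t)$, $\mathcal F^A_t=\sigma(A_s;s\le t)$, $\mathcal F^L_{t+}=\bigcap_{s>t}\mathcal F^L_s$ for $t<T$, and $\mathcal F^L_{T+}=\mathcal F^L_T$. Let $\mathcal A$ be the set of all probability measures $\mathbb P$ on $D^d\times D_\uparrow$ under which $L$ has law $\mathbb P_0$ and, for each $t\in[0,T]$, $\mathcal F^A_t$ and $\mathcal F^L_T$ are conditionally independent given $\mathcal F^L_{t+}$. Let $f:[0,T]\to[0,\infty)$ be continuous and let $g,h:\mathbb R^d\times[0,\infty)\to[0,\infty)$ be measurable, with $g(l,\cdot)$ and $h(l,\cdot)$ convex and continuously differentiable on $[0,\infty)$ for each $l$; write $g_a,h_a$ for the derivatives in the second variable (one-sided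 at $0$). A *solution of the monotone-follower problem* is a $\hat{\mathbb P}\in\mathcal A$ with $J(\hat{\mathbb P})<\infty$ and $J(\hat{\mathbb P})=\inf_{\mathbb P\in\mathcal A}J(\mathbb P)$, where $$J(\mathbb P)=\mathbb E^{\mathbb P}\Big[\int_{[0,T]}f(t)\,dA_t+\int_0^Th(L_t,A_t)\,dt+g(L_T,A_T)\Big],\qquad \int_{[0,T]}f\,dA:=f(0)A_0+\int_{(0,T]}f\,dA .$$ Let $\tau_A=\inf\{t\in[0,T]:A_t>0\}$ (with $\inf\emptyset=+\infty$) and $$Z=\Big(f(\tau_A)+g_a(L_T,0)+\int_{\tau_A}^Th_a(L_t,0)\,dt\Big)1_{\{\tau_A<\infty\}} .$$ Let $\mathcal A_S$ be the set of all $\mathbb P\in\mathcal A$ under which $Z$ is well defined a.s. and integrable, and put $K(\mathbb P)=\mathbb E^{\mathbb P}[Z]$ for $\mathbb P\in\mathcal A_S$. A *solution of the (randomized) optimal-stopping problem* is a $\hat{\mathbb P}\in\mathcal A_S$ with $K(\hat{\mathbb P})\le K(\mathbb P)$ for all $\mathbb P\in\mathcal A_S$. **Theorem.** Suppose that there are Borel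 functions $\Phi_g,\Phi_h:\mathbb R^d\to[0,\infty)$ and a constant $M\ge0$ such that $\mathbb E^{\mathbb P_0}\big[\int_0^T\Phi_h(L_t)\,dt+\Phi_g(L_T)\big]<\infty$ and $|\varphi_a(l,a)|\le\Phi_\varphi(l)+M\varphi(l,a)$ for $\varphi\in\{g,h\}$, $l\in\mathbb R^d$, $a\ge0$. Let $\hat{\mathbb P}$ be a solution of the monotone-follower problem. Then: 1. $\int_0^T|h_a(L_t,0)|\,dt<\infty$ $\mathbb P_0$-a.s., and for every $\mathbb P\in\mathcal A$ the variable $Z$ is $\mathbb P$-measurable with $\mathbb E^{\mathbb P}[Z^+]<\infty$, so that $\mathbb E^{\mathbb P}[Z]=\mathbb E^{\mathbb P}[Z^+]-\mathbb E^{\mathbb P}[Z^-]\in[-\infty,\infty)$ is well defined; 2. $\mathbb E^{\hat{\mathbb P}}[Z]\le\mathbb E^{\mathbb P}[Z]$ for every $\mathbb P\in\mathcal A$, with expectations in $[-\infty,\infty)$; 3. consequently, if $\hat{\mathbb P}\in\mathcal A_S$ (that is, if $\mathbb E^{\hat{\mathbb P}}[Z]>-\infty$), then $\hat{\mathbb P}$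 is a solution of the optimal-stopping problem. -/

import Mathlib

open MeasureTheory Set Filter Topology
open scoped ENNReal

noncomputable section

namespace MonotoneFollower

/-- A function on the time interval `[0,T]` is càdlàg: right-continuous with left limits. -/
def IsCadlag {T : ℝ} {E : Type*} [TopologicalSpace E] (x : Icc (0 : ℝ) T → E) : Prop :=
  ∀ t, ContinuousWithinAt x (Ici t) t ∧ ∃ l, Tendsto x (𝓝[<] t) (𝓝 l)

/-- The path space of all càdlàg functions `[0,T] → E`. -/
structure CadlagPath (T : ℝ) (E : Type*) [TopologicalSpace E] where
  toFun : Icc (0 : ℝ) T → E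
  cadlag : IsCadlag toFun

/-- The path space of nondecreasing càdlàg functions `A : [0,T] → ℝ` with `A 0 ≥ 0`. -/
structure IncreasingPath (T : ℝ) extends CadlagPath T ℝ where
  mono : Monotone toFun
  nonneg : ∀ t, 0 ≤ toFun t

/-- The `σ`-algebra generated by the coordinate maps. -/
instance {T : ℝ} {E : Type*} [TopologicalSpace E] [MeasurableSpace E] :
    MeasurableSpace (CadlagPath T E) :=
  MeasurableSpace.comap CadlagPath.toFun MeasurableSpace.pi

/-- The `σ`-algebra generated by the coordinate maps. -/
instance {T : ℝ} : MeasurableSpace (IncreasingPath T) :=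
  MeasurableSpace.comap (fun A => A.toFun) MeasurableSpace.pi

section Eval

variable {T : ℝ} [hT : Fact (0 < T)]

/-- The value of a path at a time `t`. Only the values for `t ∈ [0,T]` are meaningful
(the path is frozen outside of `[0,T]`). -/
def CadlagPath.eval {E : Type*} [TopologicalSpace E] (x : CadlagPath T E) (t : ℝ) : E :=
  x.toFun (projIcc 0 T hT.out.le t)

instance {E : Type*} [TopologicalSpace E] : CoeFun (CadlagPath T E) (fun _ => ℝ → E) :=
  ⟨CadlagPath.eval⟩

/-- The value of a nondecreasing path at a time `t ∈ [0,T]`. -/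
def IncreasingPath.eval (A : IncreasingPath T) (t : ℝ) : ℝ :=
  A.toFun (projIcc 0 T hT.out.le t)

instance : CoeFun (IncreasingPath T) (fun _ => ℝ → ℝ) := ⟨IncreasingPath.eval⟩

/-- The path `A`, taken to be `0` on `(-∞,0)`, as a Stieltjes function. Its Stieltjes measure
has an atom of mass `A 0` at time `0`. -/
def IncreasingPath.stieltjes (A : IncreasingPath T) : StieltjesFunction ℝ where
  toFun t := if t < 0 then 0 else A t
  mono' s t hst := by
    dsimp only
    split_ifs with hs ht ht
    · exact le_rfl
    · exact A.nonneg _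
    · exact absurd (hst.trans_lt ht) hs
    · exact A.mono (monotone_projIcc _ hst)
  right_continuous' t := by
    by_cases ht : t < 0
    · have h : (fun s : ℝ => if s < 0 then (0 : ℝ) else A s) =ᶠ[𝓝 t] fun _ => 0 := by
        filter_upwards [Iio_mem_nhds ht] with s hs
        exact if_pos hs
      exact (continuousAt_const.congr h.symm).continuousWithinAt
    · have h1 : ContinuousWithinAt (fun s : ℝ => A s) (Ici t) t :=
        ContinuousWithinAt.comp (t := Ici (projIcc 0 T hT.out.le t))
          (A.cadlag (projIcc 0 T hT.out.le t)).1 continuous_projIcc.continuousWithinAt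
          (fun s hs => mem_Ici.2 (monotone_projIcc _ (mem_Ici.1 hs)))
      refine h1.congr (fun s hs => if_neg ?_) (if_neg ht)
      exact not_lt.2 ((not_lt.1 ht).trans hs)

/-- The first time `A` becomes positive, `inf {t ∈ [0,T] : A t > 0}`, with `inf ∅ = +∞`. -/
def firstPositive (A : IncreasingPath T) : EReal :=
  sInf ((fun t : ℝ => (t : EReal)) '' {t | t ∈ Icc 0 T ∧ 0 < A t})

end Eval

/-- The sample space of pairs `(L,A)`: a càdlàg target `L` in `ℝ^d`, and a nondecreasing
one-dimensional càdlàg follower `A`. -/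
abbrev PathPair (d : ℕ) (T : ℝ) : Type :=
  CadlagPath T (EuclideanSpace ℝ (Fin d)) × IncreasingPath T

/-- The raw `σ`-algebra `σ(L_r ; r ∈ [0,T], r ≤ s)`. -/
@[reducible] def sigmaL (d : ℕ) (T : ℝ) (s : ℝ) : MeasurableSpace (PathPair d T) :=
  ⨆ (r : Icc (0 : ℝ) T) (_ : (r : ℝ) ≤ s),
    MeasurableSpace.comap (fun ω : PathPair d T => ω.1.toFun r) inferInstance

/-- The raw `σ`-algebra `σ(A_r ; r ∈ [0,T], r ≤ s)`. -/
@[reducible] def sigmaA (d : ℕ) (T : ℝ) (s : ℝ) : MeasurableSpace (PathPair d T) :=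
  ⨆ (r : Icc (0 : ℝ) T) (_ : (r : ℝ) ≤ s),
    MeasurableSpace.comap (fun ω : PathPair d T => ω.2.toFun r) inferInstance

/-- The right-continuous enlargement `⋂_{s > t} σ(L_r ; r ∈ [0,T], r ≤ s)`. At `t = T` this is
`σ(L_r ; r ∈ [0,T])`. -/
@[reducible] def sigmaLPlus (d : ℕ) (T : ℝ) (t : ℝ) : MeasurableSpace (PathPair d T) :=
  ⨅ (s : ℝ) (_ : t < s), sigmaL d T s

/-- The `σ`-algebras `m₁` and `m₂` are `P`-independent conditionally on `m`. -/
def CondIndepGiven {Ω : Type*} (m m₁ m₂ : MeasurableSpace Ω) {mΩ : MeasurableSpace Ω}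
    (P : Measure[mΩ] Ω) : Prop :=
  ∀ S₁ S₂ : Set Ω, MeasurableSet[m₁] S₁ → MeasurableSet[m₂] S₂ →
    P[(S₁ ∩ S₂).indicator (fun _ => (1 : ℝ)) | m] =ᵐ[P]
      P[S₁.indicator (fun _ => (1 : ℝ)) | m] * P[S₂.indicator (fun _ => (1 : ℝ)) | m]

/-- Admissible controls: the `L`-marginal is `P₀`, and for each `t` the past of `A` up to `t` is
independent of the whole of `L`, conditionally on the right-continuous past of `L` at `t`. -/
structure Admissible {d : ℕ} {T : ℝ} (P₀ : Measure (CadlagPath T (EuclideanSpace ℝ (Fin d))))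
    (P : Measure (PathPair d T)) : Prop where
  marginal : P.map Prod.fst = P₀
  condIndep : ∀ t ∈ Icc (0 : ℝ) T,
    CondIndepGiven (sigmaLPlus d T t) (sigmaA d T t) (sigmaL d T T) P

/-- The ingredients `f`, `g`, `h` of a cost functional, for a one-dimensional control. The
functions `f` and `g l`, `h l` matter only on `[0,T]` and on `[0,∞)`, respectively. -/
structure CostIngredients (d : ℕ) (T : ℝ) where
  f : ℝ → ℝ
  g : EuclideanSpace ℝ (Fin d) → ℝ → ℝ
  h : EuclideanSpace ℝ (Fin d) → ℝ → ℝ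
  f_nonneg : ∀ t ∈ Icc 0 T, 0 ≤ f t
  f_cont : ContinuousOn f (Icc 0 T)
  g_nonneg : ∀ l, ∀ a, 0 ≤ a → 0 ≤ g l a
  h_nonneg : ∀ l, ∀ a, 0 ≤ a → 0 ≤ h l a
  g_meas : Measurable fun p : EuclideanSpace ℝ (Fin d) × Ici (0 : ℝ) => g p.1 p.2
  h_meas : Measurable fun p : EuclideanSpace ℝ (Fin d) × Ici (0 : ℝ) => h p.1 p.2
  g_convex : ∀ l, ConvexOn ℝ (Ici 0) (g l)
  h_convex : ∀ l, ConvexOn ℝ (Ici 0) (h l)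

/-- The derivative `φ_a(l,a)` of `φ(l,·)` on `[0,∞)` (one-sided at `a = 0`). -/
def derivA {E : Type*} (φ : E → ℝ → ℝ) (l : E) (a : ℝ) : ℝ :=
  derivWithin (φ l) (Ici 0) a

section Problems

variable {d : ℕ} {T : ℝ} [hT : Fact (0 < T)]

/-- The cost `C(L,A) = ∫_{[0,T]} f dA + ∫_0^T h(L_t,A_t) dt + g(L_T,A_T) ∈ [0,∞]`, where the
first integral counts the initial jump as `f(0) A_0`. -/
def CostIngredients.cost (c : CostIngredients d T) (ω : PathPair d T) : ℝ≥0∞ :=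
  (∫⁻ t in Icc 0 T, ENNReal.ofReal (c.f t) ∂ω.2.stieltjes.measure)
    + (∫⁻ t in Icc 0 T, ENNReal.ofReal (c.h (ω.1 t) (ω.2 t)))
    + ENNReal.ofReal (c.g (ω.1 T) (ω.2 T))

/-- The expected cost `J(P)`. -/
def CostIngredients.J (c : CostIngredients d T) (P : Measure (PathPair d T)) : ℝ≥0∞ :=
  ∫⁻ ω, c.cost ω ∂P

/-- (Weak) solutions of the monotone-follower problem: admissible controls of finite cost
whose cost is the value of the problem. -/
def IsFollowerSolution (P₀ : Measure (CadlagPath T (EuclideanSpace ℝ (Fin d))))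
    (c : CostIngredients d T) (P : Measure (PathPair d T)) : Prop :=
  Admissible P₀ P ∧ c.J P < ∞ ∧
    c.J P = ⨅ (P' : Measure (PathPair d T)) (_ : Admissible P₀ P'), c.J P'

/-- The random variable
`(f(τ_A) + g_a(L_T,0) + ∫_{τ_A}^T h_a(L_t,0) dt) 1_{τ_A < ∞}`
whose expectation is minimized in the optimal-stopping problem. -/
def CostIngredients.stoppingCost (c : CostIngredients d T) (ω : PathPair d T) : ℝ :=
  open scoped Classical in
  if firstPositive ω.2 = ⊤ then 0
  else c.f (firstPositive ω.2).toReal + derivA c.g (ω.1 T) 0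
    + ∫ t in (firstPositive ω.2).toReal..T, derivA c.h (ω.1 t) 0

/-- The class `𝒜_S` of admissible `P` under which the stopping cost is well defined and
integrable. -/
def StoppingAdmissible (P₀ : Measure (CadlagPath T (EuclideanSpace ℝ (Fin d))))
    (c : CostIngredients d T) (P : Measure (PathPair d T)) : Prop :=
  Admissible P₀ P ∧
    (∀ᵐ ω ∂P, firstPositive ω.2 ≠ ⊤ → IntervalIntegrable (fun t => derivA c.h (ω.1 t) 0)
      volume (firstPositive ω.2).toReal T) ∧
    Integrable c.stoppingCost P

/-- The objective `K(P)` of the optimal-stopping problem, for `P ∈ 𝒜_S`. -/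
def CostIngredients.K (c : CostIngredients d T) (P : Measure (PathPair d T)) : ℝ :=
  ∫ ω, c.stoppingCost ω ∂P

/-- Solutions of the optimal-stopping problem. -/
def IsStoppingSolution (P₀ : Measure (CadlagPath T (EuclideanSpace ℝ (Fin d))))
    (c : CostIngredients d T) (P : Measure (PathPair d T)) : Prop :=
  StoppingAdmissible P₀ c P ∧ ∀ P', StoppingAdmissible P₀ c P' → c.K P ≤ c.K P'

/-- The expectation of the stopping cost in the extended sense, `E[Z⁺] - E[Z⁻]`. It is
meaningful, with values in `[-∞,∞)`, when `Z` is measurable and `E[Z⁺] < ∞`. -/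
def CostIngredients.extendedK (c : CostIngredients d T) (P : Measure (PathPair d T)) : EReal :=
  ((∫⁻ ω, ENNReal.ofReal (c.stoppingCost ω) ∂P : ℝ≥0∞) : EReal)
    - ((∫⁻ ω, ENNReal.ofReal (-c.stoppingCost ω) ∂P : ℝ≥0∞) : EReal)

end Problems

end MonotoneFollower

end

/-!
Let `P` be optimal and `P'` admissible. Glue `P` and `P'` along their common target `L`, so that
the start time `τ'` of the control of `P'` becomes available to the optimal control `A` without
anticipating `L`, and replace the bottom part `A ∧ ε` of `A` by a jump of size `ε` at time `τ'`.
The new control `(A - ε)⁺ + ε 1_{τ' ≤ t}` is admissible, and as `ε → 0` its cost differs from the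
cost of `A` by `ε (Z(τ') - Z(τ_A)) + o(ε)`: raising `A` by `ε` from time `τ'` on has marginal cost
`Z(τ')`, and removing `A ∧ ε` saves `ε Z(τ_A)` to first order, since for each `t > τ_A`
eventually `A_t ∧ ε = ε`. Optimality of `P` therefore gives `E[Z(τ_A)] ≤ E[Z(τ')]`. The growth
condition bounds the positive part of `Z` and dominates the error terms.
-/

noncomputable section

namespace MonotoneFollower

open scoped NNReal

section Paths

variable {T : ℝ} {E : Type*} [TopologicalSpace E]

theorem CadlagPath.measurable_toFun [MeasurableSpace E] (r : Icc (0 : ℝ) T) :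
    Measurable fun x : CadlagPath T E => x.toFun r :=
  (measurable_pi_apply r).comp (comap_measurable _)

theorem IncreasingPath.measurable_toFun (r : Icc (0 : ℝ) T) :
    Measurable fun A : IncreasingPath T => A.toFun r :=
  (measurable_pi_apply r).comp (comap_measurable fun A : IncreasingPath T => A.toFun)

theorem IncreasingPath.measurable_of_toFun {α : Type*} [MeasurableSpace α]
    {F : α → IncreasingPath T} (hF : ∀ r, Measurable fun a => (F a).toFun r) : Measurable F :=
  measurable_comap_iff.2 (measurable_pi_iff.2 hF)

theorem IncreasingPath.measurable_toCadlagPath :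
    Measurable fun A : IncreasingPath T => A.toCadlagPath :=
  measurable_comap_iff.2 (measurable_pi_iff.2 measurable_toFun)

/-- A nonnegative nondecreasing right-continuous function as a nondecreasing path; left limits
exist by monotonicity. -/
def IncreasingPath.ofRightContinuous (x : Icc (0 : ℝ) T → ℝ) (hmono : Monotone x)
    (hnonneg : ∀ t, 0 ≤ x t) (hcont : ∀ t, ContinuousWithinAt x (Ici t) t) :
    IncreasingPath T where
  toFun := x
  cadlag t := ⟨hcont t, _, hmono.tendsto_nhdsLT t⟩
  mono := hmono
  nonneg := hnonneg

instance : Nonempty (IncreasingPath T) :=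
  ⟨.ofRightContinuous (fun _ => 0) monotone_const (fun _ => le_rfl)
    fun _ => continuousWithinAt_const⟩

theorem monotone_ite_le {α : Type*} [Preorder α] (s : α) [DecidablePred (s ≤ ·)] {c : ℝ}
    (hc : 0 ≤ c) : Monotone fun t => if s ≤ t then c else 0 := by
  intro t u htu
  by_cases ht : s ≤ t
  · simp [ht, ht.trans htu]
  · by_cases hu : s ≤ u <;> simp [ht, hu, hc]

theorem continuousWithinAt_ite_le (s c t : ℝ) :
    ContinuousWithinAt (fun t => if s ≤ t then c else 0) (Ici t) t := by
  by_cases hst : s ≤ t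
  · exact continuousWithinAt_const.congr (fun u hu => if_pos (hst.trans hu)) (if_pos hst)
  · have heq : (fun u => if s ≤ u then c else 0) =ᶠ[𝓝 t] fun _ => 0 := by
      filter_upwards [Iio_mem_nhds (not_le.1 hst)] with u hu
      exact if_neg (not_le.2 hu)
    exact (continuousAt_const.congr heq.symm).continuousWithinAt

/-- The bottom part `A ∧ ε` of a nondecreasing path. -/
def IncreasingPath.bottom (A : IncreasingPath T) (ε : ℝ≥0) : IncreasingPath T :=
  .ofRightContinuous (fun t => min (A.toFun t) ε) (fun _ _ h => min_le_min_right _ (A.mono h))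
    (fun t => le_min (A.nonneg t) ε.2) fun t => (A.cadlag t).1.min continuousWithinAt_const

/-- The path `(A - ε)⁺ + ε 1_{s ≤ t}`: the bottom part `A ∧ ε` of `A` is replaced by a jump of
size `ε` at time `s`, and is removed without replacement if `s > T`. -/
def IncreasingPath.replaceBottom (A : IncreasingPath T) (ε : ℝ≥0) (s : ℝ) : IncreasingPath T :=
  .ofRightContinuous (fun t => max (A.toFun t - ε) 0 + if s ≤ (t : ℝ) then (ε : ℝ) else 0)
    (fun _ _ h => add_le_add (max_le_max_right _ (sub_le_sub_right (A.mono h) _))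
      (monotone_ite_le s ε.2 h))
    (fun _ => add_nonneg (le_max_right _ _) (by split_ifs <;> simp))
    fun t => (((A.cadlag t).1.sub continuousWithinAt_const).max continuousWithinAt_const).add
      ((continuousWithinAt_ite_le s ε t).comp continuous_subtype_val.continuousWithinAt
        fun _ h => h)

theorem IncreasingPath.measurable_bottom (ε : ℝ≥0) :
    Measurable fun A : IncreasingPath T => A.bottom ε :=
  measurable_of_toFun fun r => (measurable_toFun r).min measurable_const

theorem IncreasingPath.measurable_replaceBottom (ε : ℝ≥0) :
    Measurable fun p : IncreasingPath T × ℝ => p.1.replaceBottom ε p.2 :=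
  measurable_of_toFun fun r =>
    ((((measurable_toFun r).comp measurable_fst).sub_const _).max measurable_const).add
      (Measurable.ite (measurableSet_le measurable_snd measurable_const) measurable_const
        measurable_const)

variable [hT : Fact (0 < T)]

theorem CadlagPath.continuousWithinAt_eval (x : CadlagPath T E) (t : ℝ) :
    ContinuousWithinAt x.eval (Ici t) t :=
  ContinuousWithinAt.comp (t := Ici (projIcc 0 T hT.out.le t))
    (x.cadlag (projIcc 0 T hT.out.le t)).1 continuous_projIcc.continuousWithinAt
    fun _ hs => mem_Ici.2 (monotone_projIcc _ hs)

theorem CadlagPath.measurable_eval [MeasurableSpace E] (t : ℝ) :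
    Measurable fun x : CadlagPath T E => x t :=
  measurable_toFun _

theorem tendsto_ceil_mul_div_nhdsGE (t : ℝ) :
    Tendsto (fun n : ℕ => (⌈((n : ℝ) + 1) * t⌉ : ℝ) / ((n : ℝ) + 1)) atTop (𝓝[≥] t) := by
  have hpos (n : ℕ) : (0 : ℝ) < (n : ℝ) + 1 := n.cast_add_one_pos
  have hge (n : ℕ) : t ≤ (⌈((n : ℝ) + 1) * t⌉ : ℝ) / ((n : ℝ) + 1) := by
    rw [le_div_iff₀' (hpos n)]
    exact Int.le_ceil _
  have hle (n : ℕ) : (⌈((n : ℝ) + 1) * t⌉ : ℝ) / ((n : ℝ) + 1) ≤ t + 1 / ((n : ℝ) + 1) := by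
    rw [div_le_iff₀' (hpos n), mul_add, mul_one_div_cancel (hpos n).ne']
    exact (Int.ceil_lt_add_one _).le
  have hlim : Tendsto (fun n : ℕ => t + 1 / ((n : ℝ) + 1)) atTop (𝓝 t) := by
    simpa using tendsto_one_div_add_atTop_nhds_zero_nat.const_add t
  exact tendsto_nhdsWithin_iff.2
    ⟨tendsto_of_tendsto_of_tendsto_of_le_of_le tendsto_const_nhds hlim hge hle, .of_forall hge⟩

theorem CadlagPath.measurable_eval_uncurry [TopologicalSpace.PseudoMetrizableSpace E]
    [MeasurableSpace E] [BorelSpace E] : Measurable fun p : CadlagPath T E × ℝ => p.1 p.2 := by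
  refine measurable_of_tendsto_metrizable (f := fun (n : ℕ) (p : CadlagPath T E × ℝ) =>
    p.1 ((⌈((n : ℝ) + 1) * p.2⌉ : ℝ) / ((n : ℝ) + 1))) (fun n => ?_)
    (tendsto_pi_nhds.2 fun p =>
      (p.1.continuousWithinAt_eval p.2).tendsto.comp (tendsto_ceil_mul_div_nhdsGE p.2))
  have hgrid : Measurable fun p : CadlagPath T E × ℤ => p.1 ((p.2 : ℝ) / ((n : ℝ) + 1)) :=
    measurable_from_prod_countable_left fun k => measurable_eval ((k : ℝ) / ((n : ℝ) + 1))
  have hceil : Measurable fun p : CadlagPath T E × ℝ => (p.1, ⌈((n : ℝ) + 1) * p.2⌉) :=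
    measurable_fst.prodMk (Int.measurable_ceil.comp (measurable_snd.const_mul _))
  exact hgrid.comp hceil

theorem CadlagPath.measurable_apply [TopologicalSpace.PseudoMetrizableSpace E]
    [MeasurableSpace E] [BorelSpace E] (x : CadlagPath T E) : Measurable x.eval :=
  measurable_eval_uncurry.comp measurable_prodMk_left

namespace IncreasingPath

theorem measurable_eval_uncurry : Measurable fun p : IncreasingPath T × ℝ => p.1 p.2 :=
  CadlagPath.measurable_eval_uncurry.comp (measurable_toCadlagPath.prodMap measurable_id)

theorem eval_mono (A : IncreasingPath T) : Monotone A.eval :=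
  fun _ _ h => A.mono (monotone_projIcc _ h)

theorem eval_nonneg (A : IncreasingPath T) (t : ℝ) : 0 ≤ A t := A.nonneg _

theorem eval_of_ge (A : IncreasingPath T) {t : ℝ} (ht : T ≤ t) : A t = A T := by
  simp only [eval, projIcc_of_right_le _ ht, projIcc_right]

theorem eval_le (A : IncreasingPath T) (t : ℝ) : A t ≤ A T :=
  (le_total t T).elim (fun ht => A.eval_mono ht) fun ht => (A.eval_of_ge ht).le

theorem bottom_eval (A : IncreasingPath T) (ε : ℝ≥0) (t : ℝ) : A.bottom ε t = min (A t) ε := rfl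

theorem replaceBottom_eval (A : IncreasingPath T) (ε : ℝ≥0) (s : ℝ) {t : ℝ}
    (ht : t ∈ Icc 0 T) :
    A.replaceBottom ε s t = max (A t - ε) 0 + if s ≤ t then (ε : ℝ) else 0 := by
  simp only [eval, replaceBottom, ofRightContinuous, projIcc_of_mem _ ht]

theorem stieltjes_measure_Iic (A : IncreasingPath T) (t : ℝ) :
    A.stieltjes.measure (Iic t) = if t < 0 then 0 else ENNReal.ofReal (A t) := by
  have hlim : Tendsto A.stieltjes atBot (𝓝 0) := by
    refine tendsto_const_nhds.congr' ?_
    filter_upwards [Iio_mem_atBot (0 : ℝ)] with t ht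
    exact (if_pos ht).symm
  rw [StieltjesFunction.measure_Iic _ hlim, sub_zero]
  change ENNReal.ofReal (if t < 0 then 0 else A t) = _
  split_ifs <;> simp

theorem stieltjes_measure_univ (A : IncreasingPath T) :
    A.stieltjes.measure univ = ENNReal.ofReal (A T) := by
  refine tendsto_nhds_unique (tendsto_measure_Iic_atTop A.stieltjes.measure) ?_
  refine tendsto_const_nhds.congr' ?_
  filter_upwards [Ici_mem_atTop T] with t ht
  rw [stieltjes_measure_Iic, if_neg (hT.out.le.trans ht).not_gt, A.eval_of_ge ht]

instance (A : IncreasingPath T) : IsFiniteMeasure A.stieltjes.measure :=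
  ⟨by rw [stieltjes_measure_univ]; exact ENNReal.ofReal_lt_top⟩

theorem measurable_stieltjes_measure :
    Measurable fun A : IncreasingPath T => A.stieltjes.measure := by
  have heval (t : ℝ) : Measurable fun A : IncreasingPath T => ENNReal.ofReal (A t) :=
    (measurable_toFun _).ennreal_ofReal
  refine Measurable.measure_of_isPiSystem (borel_eq_generateFrom_Iic ℝ ▸ BorelSpace.measurable_eq)
    isPiSystem_Iic ?_ ?_
  · rintro _ ⟨t, rfl⟩
    simp only [stieltjes_measure_Iic]
    split_ifs
    exacts [measurable_const, heval t]
  · simpa only [stieltjes_measure_univ] using heval T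

theorem replaceBottom_eval_add_bottom_eval (A : IncreasingPath T) (ε : ℝ≥0) (s : ℝ) {t : ℝ}
    (ht : 0 ≤ t) :
    A.replaceBottom ε s t + A.bottom ε t = A t + if s ≤ t ∧ s ≤ T then (ε : ℝ) else 0 := by
  have hcut (a : ℝ) : max (a - ε) 0 + min a ε = a := by
    rcases le_total a ε with h | h <;> simp [h]
  rw [bottom_eval]
  rcases le_total t T with htT | htT
  · rw [replaceBottom_eval _ _ _ ⟨ht, htT⟩,
      if_congr (and_iff_left_of_imp fun h => h.trans htT) rfl rfl, add_right_comm, hcut]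
  · rw [eval_of_ge _ htT, A.eval_of_ge htT, replaceBottom_eval _ _ _ ⟨hT.out.le, le_rfl⟩,
      if_congr (and_iff_right_of_imp fun h => h.trans htT) rfl rfl, add_right_comm, hcut]

theorem stieltjes_measure_replaceBottom_add_bottom (A : IncreasingPath T) (ε : ℝ≥0) {s : ℝ}
    (hs : 0 ≤ s) :
    (A.replaceBottom ε s).stieltjes.measure + (A.bottom ε).stieltjes.measure
      = A.stieltjes.measure + (ε : ℝ≥0∞) • (Measure.dirac s).restrict (Iic T) := by
  have : IsFiniteMeasure ((ε : ℝ≥0∞) • (Measure.dirac s).restrict (Iic T)) :=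
    Measure.smul_finite _ ENNReal.coe_ne_top
  refine Measure.ext_of_Iic _ _ fun t => ?_
  have hdirac : (ε : ℝ≥0∞) * (Measure.dirac s).restrict (Iic T) (Iic t)
      = ENNReal.ofReal (if s ≤ t ∧ s ≤ T then (ε : ℝ) else 0) := by
    rw [Measure.restrict_apply measurableSet_Iic, Measure.dirac_apply' _
      (measurableSet_Iic.inter measurableSet_Iic)]
    by_cases h : s ≤ t ∧ s ≤ T <;> simp [h, indicator]
  simp only [Measure.coe_add, Pi.add_apply, stieltjes_measure_Iic, Measure.smul_apply,
    smul_eq_mul, hdirac]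
  rcases lt_or_ge t 0 with ht | ht
  · simp [ht, (ht.trans_le hs).not_ge]
  · simp only [if_neg ht.not_gt]
    rw [← ENNReal.ofReal_add (eval_nonneg _ _) (eval_nonneg _ _),
      replaceBottom_eval_add_bottom_eval _ _ _ ht,
      ENNReal.ofReal_add (eval_nonneg _ _) (by split_ifs <;> simp)]

end IncreasingPath

/-- The first time at which `A` becomes positive, as a real number; the value `T + 1` stands
for "never". -/
def startTime (A : IncreasingPath T) : ℝ :=
  sInf (insert (T + 1) {t | t ∈ Icc 0 T ∧ 0 < A t})

theorem bddBelow_startTime_set (A : IncreasingPath T) :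
    BddBelow (insert (T + 1) {t | t ∈ Icc 0 T ∧ 0 < A t}) :=
  BddBelow.insert _ ⟨0, fun _ ht => ht.1.1⟩

theorem startTime_nonneg (A : IncreasingPath T) : 0 ≤ startTime A :=
  Real.sInf_nonneg (forall_mem_insert.2 ⟨by linarith [hT.out], fun _ ht => ht.1.1⟩)

theorem startTime_le_add_one (A : IncreasingPath T) : startTime A ≤ T + 1 :=
  csInf_le (bddBelow_startTime_set A) (mem_insert _ _)

theorem startTime_le_of_pos {A : IncreasingPath T} {t : ℝ} (ht : t ∈ Icc 0 T) (h : 0 < A t) :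
    startTime A ≤ t :=
  csInf_le (bddBelow_startTime_set A) (mem_insert_of_mem _ ⟨ht, h⟩)

theorem pos_of_startTime_lt {A : IncreasingPath T} {t : ℝ} (ht : t ≤ T + 1)
    (h : startTime A < t) : 0 < A t := by
  obtain ⟨u, rfl | ⟨-, hu⟩, hut⟩ := exists_lt_of_csInf_lt (insert_nonempty _ _) h
  · exact absurd hut ht.not_gt
  · exact hu.trans_le (A.eval_mono hut.le)

theorem startTime_le_iff_pos {A : IncreasingPath T} {r : ℝ} (hr : r ∈ Ico T (T + 1)) :
    startTime A ≤ r ↔ 0 < A T := by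
  refine ⟨fun h => ?_, fun h => (startTime_le_of_pos ⟨hT.out.le, le_rfl⟩ h).trans hr.1⟩
  have hpos := pos_of_startTime_lt le_rfl (h.trans_lt hr.2)
  rwa [A.eval_of_ge (by linarith)] at hpos

theorem ae_startTime_le_iff_pos (A : IncreasingPath T) :
    ∀ᵐ t ∂volume.restrict (Icc 0 T), startTime A ≤ t ↔ 0 < A t := by
  rw [ae_restrict_iff' measurableSet_Icc]
  filter_upwards [compl_mem_ae_iff.2 (measure_singleton (startTime A))] with t hne ht
  exact ⟨fun h => pos_of_startTime_lt (by linarith [ht.2]) (h.lt_of_ne' hne),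
    startTime_le_of_pos ht⟩

theorem firstPositive_eq_top_iff {A : IncreasingPath T} :
    firstPositive A = ⊤ ↔ ¬ startTime A ≤ T := by
  rw [startTime_le_iff_pos ⟨le_rfl, lt_add_one T⟩, firstPositive, sInf_eq_top]
  refine ⟨fun h hpos => EReal.coe_ne_top T (h _ ⟨T, ⟨⟨hT.out.le, le_rfl⟩, hpos⟩, rfl⟩), ?_⟩
  rintro h _ ⟨t, ⟨ht, hpos⟩, rfl⟩
  exact absurd (hpos.trans_le (A.eval_mono ht.2)) h

theorem firstPositive_eq_startTime {A : IncreasingPath T} (h : startTime A ≤ T) :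
    firstPositive A = (startTime A : EReal) := by
  refine le_antisymm (EReal.le_of_forall_lt_iff_le.1 fun z hz => ?_)
    (le_sInf (forall_mem_image.2 fun t ht =>
      EReal.coe_le_coe_iff.2 (startTime_le_of_pos ht.1 ht.2)))
  have hlt : startTime A < min z (T + 1) :=
    lt_min (EReal.coe_lt_coe_iff.1 hz) (h.trans_lt (lt_add_one T))
  obtain ⟨u, rfl | hu, huz⟩ := exists_lt_of_csInf_lt (insert_nonempty _ _) hlt
  · exact absurd huz (min_le_right _ _).not_gt
  · exact (sInf_le (mem_image_of_mem _ hu)).trans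
      (EReal.coe_le_coe_iff.2 (huz.le.trans (min_le_left _ _)))

theorem startTime_le_iff_forall_rat {A : IncreasingPath T} {r s : ℝ} (hr : 0 ≤ r) (hrs : r < s)
    (hs : s ≤ T) : startTime A ≤ r ↔ ∀ q : ℚ, (q : ℝ) ∈ Ioo r s → 0 < A q := by
  refine ⟨fun h q hq => pos_of_startTime_lt (by linarith [hq.2]) (h.trans_lt hq.1), fun h => ?_⟩
  by_contra! hlt
  obtain ⟨q, hrq, hq⟩ := exists_rat_btwn (lt_min hlt hrs)
  obtain ⟨hqτ, hqs⟩ := lt_min_iff.1 hq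
  exact hqτ.not_ge (startTime_le_of_pos ⟨hr.trans hrq.le, hqs.le.trans hs⟩ (h q ⟨hrq, hqs⟩))

end Paths

section ConditionalProbability

open ProbabilityTheory

variable {Ω X : Type*} {m m' : MeasurableSpace X} {m₁ : MeasurableSpace Ω}
  {mX : MeasurableSpace X} {mΩ : MeasurableSpace Ω} {π : Ω → X} {P : Measure Ω} {S : Set Ω}

theorem measurable_limsup_iInf {m : ℝ → MeasurableSpace X} (hmono : Monotone m) {t : ℝ}
    {u : ℕ → X → ℝ≥0∞} (hu : ∀ n : ℕ, Measurable[m (t + 1 / ((n : ℝ) + 1))] (u n)) :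
    Measurable[⨅ (s : ℝ) (_ : t < s), m s] fun x => limsup (fun n => u n x) atTop := by
  intro B hB
  simp only [MeasurableSpace.measurableSet_iInf]
  intro s hs
  obtain ⟨N, hN⟩ := exists_nat_one_div_lt (sub_pos.2 hs)
  have htail : (fun x => limsup (fun n => u n x) atTop)
      = fun x => limsup (fun n => u (n + N) x) atTop := by
    funext x
    exact (limsup_nat_add (fun n => u n x) N).symm
  rw [htail]
  refine Measurable.limsup (mδ := m s) (fun n => (hu (n + N)).mono (hmono ?_) le_rfl) hB
  have hle : 1 / (((n + N : ℕ) : ℝ) + 1) ≤ 1 / ((N : ℝ) + 1) :=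
    Nat.one_div_le_one_div (Nat.le_add_left N n)
  linarith

theorem map_restrict_eq_withDensity (hπ : Measurable π) {u : X → ℝ≥0∞}
    (hSu : ∀ B, MeasurableSet B → P (π ⁻¹' B ∩ S) = ∫⁻ x in B, u x ∂P.map π) :
    (P.restrict S).map π = (P.map π).withDensity u := by
  refine Measure.ext fun B hB => ?_
  rw [withDensity_apply _ hB, ← hSu B hB, Measure.map_apply hπ hB, Measure.restrict_apply (hπ hB)]

/-- The conditional probability of `S` given the random variable `π` has an `m`-measurable
version. -/
def HasCondProb (m : MeasurableSpace X) [MeasurableSpace X] (π : Ω → X)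
    {_ : MeasurableSpace Ω} (P : Measure Ω) (S : Set Ω) : Prop :=
  ∃ u : X → ℝ≥0∞, Measurable[m] u ∧
    ∀ B, MeasurableSet B → P (π ⁻¹' B ∩ S) = ∫⁻ x in B, u x ∂P.map π

namespace HasCondProb

theorem mono (h : HasCondProb m π P S) (hm : m ≤ m') : HasCondProb m' π P S :=
  let ⟨u, hu, hS⟩ := h
  ⟨u, hu.mono hm le_rfl, hS⟩

theorem univ (hπ : Measurable π) : HasCondProb m π P univ :=
  ⟨1, measurable_const, fun B hB => by simp [Measure.map_apply hπ hB]⟩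

theorem compl [IsFiniteMeasure P] (hm : m ≤ mX) (hπ : Measurable π) (hS : MeasurableSet S)
    (h : HasCondProb m π P S) : HasCondProb m π P Sᶜ := by
  obtain ⟨u, hu, hSu⟩ := h
  have hu' : Measurable u := hu.mono hm le_rfl
  have hone {B : Set X} (hB : MeasurableSet B) : ∫⁻ _ in B, 1 ∂P.map π = P (π ⁻¹' B) := by
    rw [setLIntegral_one, Measure.map_apply hπ hB]
  have hle : u ≤ᵐ[P.map π] fun _ => 1 := by
    refine ae_le_of_forall_setLIntegral_le_of_sigmaFinite hu' fun B hB _ => ?_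
    rw [← hSu B hB, hone hB]
    exact measure_mono inter_subset_left
  refine ⟨fun x => 1 - u x, measurable_const.sub hu, fun B hB => ?_⟩
  rw [lintegral_sub hu' (hSu B hB ▸ measure_ne_top _ _) (ae_restrict_of_ae hle), ← hSu B hB,
    hone hB]
  refine ENNReal.eq_sub_of_add_eq (measure_ne_top _ _) ?_
  rw [← sdiff_eq, add_comm, measure_inter_add_sdiff _ hS]

theorem iUnion (hm : m ≤ mX) (hπ : Measurable π) {S : ℕ → Set Ω}
    (hd : Pairwise (Function.onFun Disjoint S)) (hS : ∀ n, MeasurableSet (S n))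
    (h : ∀ n, HasCondProb m π P (S n)) : HasCondProb m π P (⋃ n, S n) := by
  choose u hu hSu using h
  refine ⟨fun x => ∑' n, u n x, @Measurable.tsum X ℝ≥0∞ ℕ m _ _ _ _ _ _ _ _ _ _ _ _ hu,
    fun B hB => ?_⟩
  rw [lintegral_tsum fun n => ((hu n).mono hm le_rfl).aemeasurable, inter_iUnion,
    measure_iUnion (fun i j hij => (hd hij).mono inter_subset_right inter_subset_right)
      fun n => (hπ hB).inter (hS n)]
  exact tsum_congr fun n => hSu n B hB

theorem of_generateFrom [IsFiniteMeasure P] (hm : m ≤ mX) (hπ : Measurable π)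
    {C : Set (Set Ω)} (hC : IsPiSystem C) (hCm : ∀ S ∈ C, MeasurableSet S)
    (h : ∀ S ∈ C, HasCondProb m π P S) (hS : MeasurableSet[MeasurableSpace.generateFrom C] S) :
    HasCondProb m π P S := by
  have hle : MeasurableSpace.generateFrom C ≤ mΩ := MeasurableSpace.generateFrom_le hCm
  induction S, hS using MeasurableSpace.induction_on_inter rfl hC with
  | empty => simpa using (univ hπ).compl hm hπ MeasurableSet.univ
  | basic S hS => exact h S hS
  | compl S hS ih => exact ih.compl hm hπ (hle _ hS)
  | iUnion S hd hS ih => exact iUnion hm hπ hd (fun n => hle _ (hS n)) ih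

theorem iInf [IsFiniteMeasure P] {m : ℝ → MeasurableSpace X} {mX : MeasurableSpace X}
    (hmono : Monotone m) (hm : ∀ s, m s ≤ mX) {t : ℝ} (h : ∀ s, t < s → HasCondProb (m s) π P S) :
    HasCondProb (⨅ (s : ℝ) (_ : t < s), m s) π P S := by
  choose u hu hSu using fun n : ℕ => h (t + 1 / ((n : ℝ) + 1))
    (lt_add_of_pos_right t Nat.one_div_pos_of_nat)
  have hmeas (n : ℕ) : Measurable (u n) := (hu n).mono (hm _) le_rfl
  have heq (n : ℕ) : u n =ᵐ[P.map π] u 0 :=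
    ae_eq_of_forall_setLIntegral_eq_of_sigmaFinite (hmeas n) (hmeas 0)
      fun B hB _ => (hSu n B hB).symm.trans (hSu 0 B hB)
  refine ⟨_, measurable_limsup_iInf hmono hu, fun B hB => ?_⟩
  rw [hSu 0 B hB]
  refine lintegral_congr_ae (ae_restrict_of_ae ?_)
  filter_upwards [ae_all_iff.2 heq] with x hx
  simp [hx]

theorem map {Ω' : Type*} {mΩ' : MeasurableSpace Ω'} {F : Ω' → Ω} {Q : Measure Ω'}
    (hF : Measurable F) (hπ : Measurable π) (hS : MeasurableSet S)
    (h : HasCondProb m (π ∘ F) Q (F ⁻¹' S)) : HasCondProb m π (Q.map F) S := by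
  obtain ⟨u, hu, hSu⟩ := h
  refine ⟨u, hu, fun B hB => ?_⟩
  rw [Measure.map_map hπ hF, ← hSu B hB, Measure.map_apply hF ((hπ hB).inter hS)]
  rfl

theorem compProd {Y : Type*} {mY : MeasurableSpace Y} [IsFiniteMeasure P] {κ : Kernel X Y}
    [IsMarkovKernel κ] (hm : m ≤ mX) (hπ : Measurable π) {R : Set Y} (hS : MeasurableSet S)
    (hR : MeasurableSet R) (h : HasCondProb m π P S)
    (hκ : ∃ v : X → ℝ≥0∞, Measurable[m] v ∧ (fun x => κ x R) =ᵐ[P.map π] v) :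
    HasCondProb m (π ∘ Prod.fst) (P ⊗ₘ κ.comap π hπ) (S ×ˢ R) := by
  obtain ⟨u, hu, hSu⟩ := h
  obtain ⟨v, hv, hκv⟩ := hκ
  have hmarg : (P ⊗ₘ κ.comap π hπ).map (π ∘ Prod.fst) = P.map π := by
    rw [← Measure.map_map hπ measurable_fst]
    exact congrArg _ (Measure.fst_compProd P _)
  refine ⟨u * v, hu.mul hv, fun B hB => ?_⟩
  have hset : (π ∘ Prod.fst) ⁻¹' B ∩ S ×ˢ R = (π ⁻¹' B ∩ S) ×ˢ R := by
    ext p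
    simp [and_assoc]
  have hκR : Measurable fun x => κ x R := κ.measurable_coe hR
  rw [hmarg, hset, Measure.compProd_apply_prod ((hπ hB).inter hS) hR]
  simp only [Kernel.comap_apply]
  rw [← Measure.restrict_restrict (hπ hB), ← setLIntegral_map hB hκR hπ,
    map_restrict_eq_withDensity hπ hSu, restrict_withDensity hB,
    lintegral_withDensity_eq_lintegral_mul _ (hu.mono hm le_rfl) hκR]
  refine lintegral_congr_ae ?_
  filter_upwards [ae_restrict_of_ae hκv] with x hx
  simp [hx]

theorem condDistrib {Y : Type*} {mY : MeasurableSpace Y} [StandardBorelSpace Y] [Nonempty Y]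
    [IsFiniteMeasure P] {τ : Ω → Y} (hm : m ≤ mX) (hπ : Measurable π) (hτ : Measurable τ)
    {R : Set Y} (hR : MeasurableSet R) (h : HasCondProb m π P (τ ⁻¹' R)) :
    ∃ v : X → ℝ≥0∞, Measurable[m] v ∧
      (fun x => ProbabilityTheory.condDistrib τ π P x R) =ᵐ[P.map π] v := by
  obtain ⟨u, hu, hRu⟩ := h
  refine ⟨u, hu, ae_eq_of_forall_setLIntegral_eq_of_sigmaFinite (Kernel.measurable_coe _ hR)
    (hu.mono hm le_rfl) fun B hB _ => ?_⟩
  rw [← hRu B hB, ← Measure.compProd_apply_prod hB hR,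
    compProd_map_condDistrib hτ.aemeasurable, Measure.map_apply (hπ.prodMk hτ) (hB.prod hR)]
  rfl

theorem exists_condExp_ae_eq [IsFiniteMeasure P] (hm : m ≤ mX) (hπ : Measurable π)
    (hS : MeasurableSet S) (h : HasCondProb m π P S) :
    ∃ r : Ω → ℝ, StronglyMeasurable[m.comap π] r ∧ ∀ m', m ≤ m' → m' ≤ mX →
      r =ᵐ[P] P[S.indicator (fun _ => (1 : ℝ)) | m'.comap π] := by
  obtain ⟨u, hu, hSu⟩ := h
  have hu' : Measurable u := hu.mono hm le_rfl
  have hfin : ∫⁻ ω, u (π ω) ∂P ≠ ∞ := by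
    rw [← lintegral_map hu' hπ, ← setLIntegral_univ, ← hSu _ MeasurableSet.univ]
    exact measure_ne_top _ _
  have hr : StronglyMeasurable[m.comap π] fun ω => (u (π ω)).toReal :=
    (hu.ennreal_toReal.comp (comap_measurable π)).stronglyMeasurable
  have hset {B : Set X} (hB : MeasurableSet B) :
      ∫ ω in π ⁻¹' B, (u (π ω)).toReal ∂P = ∫ ω in π ⁻¹' B, S.indicator (fun _ => 1) ω ∂P := by
    rw [integral_toReal (f := fun ω => u (π ω)) (hu'.comp hπ).aemeasurable
        (ae_restrict_of_ae (ae_lt_top (hu'.comp hπ) hfin)),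
      ← setLIntegral_map hB hu' hπ, ← hSu B hB, setIntegral_indicator hS,
      setIntegral_const, smul_eq_mul, mul_one, measureReal_def]
  refine ⟨_, hr, fun m' hmm' hm' => ?_⟩
  have hle : m'.comap π ≤ mΩ := (MeasurableSpace.comap_mono hm').trans hπ.comap_le
  have hint : Integrable (fun ω => (u (π ω)).toReal) P :=
    integrable_toReal_of_lintegral_ne_top (hu'.comp hπ).aemeasurable hfin
  refine ae_eq_condExp_of_forall_setIntegral_eq hle ((integrable_const 1).indicator hS)
    (fun _ _ _ => hint.integrableOn) ?_
    (hr.mono (MeasurableSpace.comap_mono hmm')).aestronglyMeasurable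
  rintro _ ⟨B, hB, rfl⟩ -
  exact hset (hm' _ hB)

end HasCondProb

theorem CondIndepGiven.hasCondProb [IsFiniteMeasure P] (hm : m ≤ mX)
    (hπ : Measurable π) (hm₁ : m₁ ≤ mΩ) (h : CondIndepGiven (m.comap π) m₁ (mX.comap π) P)
    (hS : MeasurableSet[m₁] S) : HasCondProb m π P S := by
  have hle : m.comap π ≤ mΩ := (MeasurableSpace.comap_mono hm).trans hπ.comap_le
  obtain ⟨w, hw, hcond⟩ := StronglyMeasurable.exists_eq_measurable_comp (mY := m) (f := π)
    (stronglyMeasurable_condExp (m := m.comap π) (μ := P) (f := S.indicator fun _ => (1 : ℝ)))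
  have hnonneg : 0 ≤ᵐ[P] w ∘ π := hcond ▸
    condExp_nonneg (.of_forall (indicator_nonneg fun _ _ => zero_le_one))
  have hint : Integrable (w ∘ π) P := hcond ▸ integrable_condExp
  refine ⟨fun x => ENNReal.ofReal (w x), hw.measurable.ennreal_ofReal, fun B hB => ?_⟩
  have hprod : (w ∘ π) * (π ⁻¹' B).indicator (fun _ => (1 : ℝ)) = (π ⁻¹' B).indicator (w ∘ π) := by
    funext x
    by_cases hx : x ∈ π ⁻¹' B <;> simp [hx]
  have hset : ∫ x in π ⁻¹' B, w (π x) ∂P = P.real (S ∩ π ⁻¹' B) := calc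
    _ = ∫ x, ((w ∘ π) * (π ⁻¹' B).indicator (fun _ => (1 : ℝ))) x ∂P := by
      rw [hprod, integral_indicator (hπ hB)]; rfl
    _ = ∫ x, (P[(w ∘ π) * (π ⁻¹' B).indicator (fun _ => (1 : ℝ)) | m.comap π]) x ∂P :=
      (integral_condExp hle).symm
    _ = ∫ x, (P[(S ∩ π ⁻¹' B).indicator (fun _ => (1 : ℝ)) | m.comap π]) x ∂P :=
      integral_congr_ae ((condExp_mul_of_stronglyMeasurable_left
        (hcond ▸ stronglyMeasurable_condExp) (hprod ▸ hint.indicator (hπ hB))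
        ((integrable_const 1).indicator (hπ hB))).trans
          (hcond ▸ (h S (π ⁻¹' B) hS ⟨B, hB, rfl⟩).symm))
    _ = P.real (S ∩ π ⁻¹' B) := by
      rw [integral_condExp hle, integral_indicator_const _ ((hm₁ _ hS).inter (hπ hB)),
        smul_eq_mul, mul_one]
  rw [setLIntegral_map hB (hw.measurable.mono hm le_rfl).ennreal_ofReal hπ,
    ← ofReal_integral_eq_lintegral_ofReal (f := fun ω => w (π ω)) hint.integrableOn
      (ae_restrict_of_ae hnonneg), hset, inter_comm, ofReal_measureReal]

theorem condIndepGiven_of_hasCondProb [IsFiniteMeasure P] (hm : m ≤ mX)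
    (hπ : Measurable π) (hm₁ : m₁ ≤ mΩ) (h : ∀ S, MeasurableSet[m₁] S → HasCondProb m π P S) :
    CondIndepGiven (m.comap π) m₁ (mX.comap π) P := by
  rintro S _ hS ⟨D, hD, rfl⟩
  have hD' : MeasurableSet[mX.comap π] (π ⁻¹' D) := ⟨D, hD, rfl⟩
  obtain ⟨r, hr, hcond⟩ := (h S hS).exists_condExp_ae_eq hm hπ (hm₁ _ hS)
  have hintS : Integrable (S.indicator fun _ => (1 : ℝ)) P :=
    (integrable_const 1).indicator (hm₁ _ hS)
  have hintD : Integrable ((π ⁻¹' D).indicator fun _ => (1 : ℝ)) P :=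
    (integrable_const 1).indicator (hπ hD)
  have hprod (v : Ω → ℝ) : v * (π ⁻¹' D).indicator (fun _ => (1 : ℝ)) = (π ⁻¹' D).indicator v := by
    funext x
    by_cases hx : x ∈ π ⁻¹' D <;> simp [hx]
  have hinter : (S ∩ π ⁻¹' D).indicator (fun _ => (1 : ℝ))
      = S.indicator (fun _ => (1 : ℝ)) * (π ⁻¹' D).indicator (fun _ => (1 : ℝ)) := by
    rw [hprod, indicator_indicator, inter_comm]
  have hintr : Integrable (r * (π ⁻¹' D).indicator (fun _ => (1 : ℝ))) P :=
    hprod r ▸ (integrable_condExp.congr (hcond m le_rfl hm).symm).indicator (hπ hD)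
  calc P[(S ∩ π ⁻¹' D).indicator (fun _ => (1 : ℝ)) | m.comap π]
      =ᵐ[P] P[P[(S ∩ π ⁻¹' D).indicator (fun _ => (1 : ℝ)) | mX.comap π] | m.comap π] :=
        (condExp_condExp_of_le (MeasurableSpace.comap_mono hm) hπ.comap_le).symm
    _ =ᵐ[P] P[r * (π ⁻¹' D).indicator (fun _ => (1 : ℝ)) | m.comap π] := by
        refine condExp_congr_ae ?_
        rw [hinter]
        refine (condExp_mul_of_stronglyMeasurable_right
          (stronglyMeasurable_const.indicator hD')
          (by rw [hprod]; exact hintS.indicator (hπ hD)) hintS).trans ?_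
        exact (hcond mX hm le_rfl).symm.mul EventuallyEq.rfl
    _ =ᵐ[P] r * P[(π ⁻¹' D).indicator (fun _ => (1 : ℝ)) | m.comap π] :=
        condExp_mul_of_stronglyMeasurable_left hr hintr hintD
    _ =ᵐ[P] P[S.indicator (fun _ => (1 : ℝ)) | m.comap π]
          * P[(π ⁻¹' D).indicator (fun _ => (1 : ℝ)) | m.comap π] :=
        (hcond m le_rfl hm).mul EventuallyEq.rfl

end ConditionalProbability

section Gluing

open ProbabilityTheory

section PathSigma

variable {T : ℝ} {E : Type*} [TopologicalSpace E] [mE : MeasurableSpace E]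

/-- The raw `σ`-algebra `σ(x_r ; r ≤ s)` on the space of càdlàg paths; `sigmaL` is its pullback
to the pairs `(L,A)`. -/
@[reducible] def pathSigma (T : ℝ) (E : Type*) [TopologicalSpace E] [MeasurableSpace E] (s : ℝ) :
    MeasurableSpace (CadlagPath T E) :=
  ⨆ (r : Icc (0 : ℝ) T) (_ : (r : ℝ) ≤ s),
    MeasurableSpace.comap (fun x : CadlagPath T E => x.toFun r) inferInstance

/-- The right-continuous enlargement of `pathSigma`; `sigmaLPlus` is its pullback. -/
@[reducible] def pathSigmaPlus (T : ℝ) (E : Type*) [TopologicalSpace E] [MeasurableSpace E]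
    (t : ℝ) : MeasurableSpace (CadlagPath T E) :=
  ⨅ (s : ℝ) (_ : t < s), pathSigma T E s

theorem pathSigma_mono : Monotone (pathSigma T E) := fun _ _ h =>
  iSup_mono fun _ => iSup_mono' fun h' => ⟨h'.trans h, le_rfl⟩

theorem pathSigma_le (s : ℝ) :
    pathSigma T E s ≤ (inferInstance : MeasurableSpace (CadlagPath T E)) :=
  iSup₂_le fun r _ => (CadlagPath.measurable_toFun r).comap_le

theorem pathSigma_eq_of_le {s : ℝ} (h : T ≤ s) :
    pathSigma T E s = (inferInstance : MeasurableSpace (CadlagPath T E)) := by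
  refine le_antisymm (pathSigma_le s) ?_
  change MeasurableSpace.comap CadlagPath.toFun (⨆ r, MeasurableSpace.comap _ _) ≤ _
  rw [MeasurableSpace.comap_iSup]
  refine iSup_le fun r => ?_
  rw [MeasurableSpace.comap_comp]
  exact le_iSup₂_of_le r (r.2.2.trans h) le_rfl

theorem pathSigmaPlus_le_pathSigma {t s : ℝ} (h : t < s) :
    pathSigmaPlus T E t ≤ pathSigma T E s :=
  iInf₂_le s h

theorem pathSigmaPlus_le (t : ℝ) :
    pathSigmaPlus T E t ≤ (inferInstance : MeasurableSpace (CadlagPath T E)) :=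
  (pathSigmaPlus_le_pathSigma (lt_add_one t)).trans (pathSigma_le _)

end PathSigma

variable {d : ℕ} {T : ℝ}

theorem sigmaL_eq (s : ℝ) : sigmaL d T s = (pathSigma T _ s).comap Prod.fst := by
  simp only [sigmaL, pathSigma, MeasurableSpace.comap_iSup, MeasurableSpace.comap_comp]
  rfl

theorem sigmaL_eq_comap_fst : sigmaL d T T = MeasurableSpace.comap Prod.fst inferInstance := by
  rw [sigmaL_eq, pathSigma_eq_of_le le_rfl]

theorem sigmaLPlus_eq (t : ℝ) : sigmaLPlus d T t = (pathSigmaPlus T _ t).comap Prod.fst := by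
  refine le_antisymm (fun S hS => ?_) (le_iInf₂ fun s hs => ?_)
  · have hpre (s : ℝ) (hs : t < s) :
        ∃ B, MeasurableSet[pathSigma T _ s] B ∧ Prod.fst ⁻¹' B = S := by
      have hle : sigmaLPlus d T t ≤ sigmaL d T s := iInf₂_le s hs
      exact (sigmaL_eq s ▸ hle) S hS
    obtain ⟨B, -, rfl⟩ := hpre (t + 1) (lt_add_one t)
    refine ⟨B, ?_, rfl⟩
    simp only [MeasurableSpace.measurableSet_iInf]
    intro s hs
    obtain ⟨B', hB', h⟩ := hpre s hs
    rwa [← Prod.fst_surjective.preimage_injective h]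
  · exact sigmaL_eq (d := d) (T := T) s ▸
      MeasurableSpace.comap_mono (pathSigmaPlus_le_pathSigma hs)

theorem sigmaA_le (s : ℝ) : sigmaA d T s ≤ (inferInstance : MeasurableSpace (PathPair d T)) :=
  iSup₂_le fun r _ => ((IncreasingPath.measurable_toFun r).comp measurable_snd).comap_le

theorem measurable_toFun_sigmaA {r : Icc (0 : ℝ) T} {t : ℝ} (h : (r : ℝ) ≤ t) :
    Measurable[sigmaA d T t] fun ω : PathPair d T => ω.2.toFun r :=
  measurable_iff_comap_le.2 (le_iSup₂_of_le (f := fun (r : Icc (0 : ℝ) T) (_ : (r : ℝ) ≤ t) =>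
    MeasurableSpace.comap (fun ω : PathPair d T => ω.2.toFun r) inferInstance) r h le_rfl)

section Admissible

variable {P₀ : Measure (CadlagPath T (EuclideanSpace ℝ (Fin d)))} {P : Measure (PathPair d T)}

theorem admissible_iff [IsFiniteMeasure P] :
    Admissible P₀ P ↔ P.map Prod.fst = P₀ ∧ ∀ t ∈ Icc (0 : ℝ) T, ∀ S,
      MeasurableSet[sigmaA d T t] S → HasCondProb (pathSigmaPlus T _ t) Prod.fst P S := by
  refine ⟨fun h => ⟨h.marginal, fun t ht S hS => ?_⟩, fun h => ⟨h.1, fun t ht => ?_⟩⟩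
  · have hcond := h.condIndep t ht
    rw [sigmaLPlus_eq, sigmaL_eq_comap_fst] at hcond
    exact hcond.hasCondProb (pathSigmaPlus_le t) measurable_fst (sigmaA_le t) hS
  · rw [sigmaLPlus_eq, sigmaL_eq_comap_fst]
    exact condIndepGiven_of_hasCondProb (pathSigmaPlus_le t) measurable_fst (sigmaA_le t)
      (h.2 t ht)

theorem Admissible.isProbabilityMeasure [IsProbabilityMeasure P₀] (h : Admissible P₀ P) :
    IsProbabilityMeasure P :=
  have : IsProbabilityMeasure (P.map Prod.fst) := h.marginal.symm ▸ inferInstance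
  Measure.isProbabilityMeasure_of_map Prod.fst

end Admissible

/-- The pair consisting of the target and the control whose bottom part has been replaced by a
jump at the time given by the last coordinate. -/
def replaceMap (ε : ℝ≥0) (p : PathPair d T × ℝ) : PathPair d T :=
  (p.1.1, p.1.2.replaceBottom ε p.2)

theorem measurable_replaceMap (ε : ℝ≥0) : Measurable (replaceMap (d := d) (T := T) ε) :=
  (measurable_fst.comp measurable_fst).prodMk ((IncreasingPath.measurable_replaceBottom ε).comp
    ((measurable_snd.comp measurable_fst).prodMk measurable_snd))

/-- The `σ`-algebra on `ℝ` generated by the half-lines `(-∞,r]`, `r ≤ t`: what is known at time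
`t` about a random time. -/
@[reducible] def stopSigma (t : ℝ) : MeasurableSpace ℝ :=
  MeasurableSpace.generateFrom (Iic '' Iic t)

theorem stopSigma_le (t : ℝ) : stopSigma t ≤ (inferInstance : MeasurableSpace ℝ) :=
  MeasurableSpace.generateFrom_le (forall_mem_image.2 fun _ _ => measurableSet_Iic)

theorem measurable_replaceMap_sigmaA (ε : ℝ≥0) (t : ℝ) :
    Measurable[(sigmaA d T t).prod (stopSigma t), sigmaA d T t] (replaceMap ε) := by
  simp only [measurable_iff_comap_le, sigmaA, MeasurableSpace.comap_iSup,
    MeasurableSpace.comap_comp]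
  refine iSup₂_le fun r hr => measurable_iff_comap_le.1 ?_
  have hA : Measurable[(sigmaA d T t).prod (stopSigma t)]
      fun p : PathPair d T × ℝ => p.1.2.toFun r :=
    (measurable_toFun_sigmaA hr).comp (@measurable_fst _ _ (sigmaA d T t) (stopSigma t))
  have hle : MeasurableSet[(sigmaA d T t).prod (stopSigma t)]
      {p : PathPair d T × ℝ | p.2 ≤ r} :=
    @measurable_snd _ _ (sigmaA d T t) (stopSigma t) _
      (MeasurableSpace.measurableSet_generateFrom ⟨(r : ℝ), hr, rfl⟩)
  exact ((hA.sub_const _).max measurable_const).add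
    (Measurable.ite hle measurable_const measurable_const)

variable [hT : Fact (0 < T)]

theorem measurableSet_sigmaA_pos {t s : ℝ} (ht : t ∈ Icc 0 T) (hts : t ≤ s) :
    MeasurableSet[sigmaA d T s] {ω : PathPair d T | 0 < ω.2 t} :=
  measurable_toFun_sigmaA (r := projIcc 0 T hT.out.le t)
    (by rwa [projIcc_of_mem _ ht]) measurableSet_Ioi

theorem measurableSet_startTime_le_of_lt {r s : ℝ} (hrs : r < s) (hs : s ≤ T) :
    MeasurableSet[sigmaA d T s] {ω : PathPair d T | startTime ω.2 ≤ r} := by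
  rcases lt_or_ge r 0 with hr | hr
  · simp only [fun A : IncreasingPath T => (hr.trans_le (startTime_nonneg A)).not_ge, ofPred_false]
    exact @MeasurableSet.empty _ (sigmaA d T s)
  · simp only [startTime_le_iff_forall_rat hr hrs hs, ofPred_forall]
    exact MeasurableSet.iInter fun q => MeasurableSet.iInter fun hq =>
      measurableSet_sigmaA_pos ⟨hr.trans hq.1.le, hq.2.le.trans hs⟩ hq.2.le

theorem measurableSet_startTime_le {r : ℝ} (hr : r ≤ T) :
    MeasurableSet[sigmaA d T T] {ω : PathPair d T | startTime ω.2 ≤ r} := by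
  rcases hr.lt_or_eq with h | rfl
  · exact measurableSet_startTime_le_of_lt h le_rfl
  · simp only [startTime_le_iff_pos ⟨le_rfl, lt_add_one r⟩]
    exact measurableSet_sigmaA_pos ⟨hT.out.le, le_rfl⟩ le_rfl

theorem measurable_startTime_snd : Measurable fun ω : PathPair d T => startTime ω.2 := by
  refine measurable_of_Iic fun r => ?_
  change MeasurableSet {ω : PathPair d T | startTime ω.2 ≤ r}
  rcases le_or_gt r T with hrT | hTr
  · exact sigmaA_le T _ (measurableSet_startTime_le hrT)
  rcases lt_or_ge r (T + 1) with hr | hr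
  · simp only [startTime_le_iff_pos ⟨hTr.le, hr⟩]
    exact sigmaA_le T _ (measurableSet_sigmaA_pos ⟨hT.out.le, le_rfl⟩ le_rfl)
  · simp only [fun A : IncreasingPath T => (startTime_le_add_one A).trans hr, ofPred_true]
    exact MeasurableSet.univ

variable {P₀ : Measure (CadlagPath T (EuclideanSpace ℝ (Fin d)))} {P P' : Measure (PathPair d T)}

theorem Admissible.hasCondProb_startTime_le [IsFiniteMeasure P] (h : Admissible P₀ P) {r t : ℝ}
    (ht : t ∈ Icc 0 T) (hr : r ≤ t) :
    HasCondProb (pathSigmaPlus T _ t) Prod.fst P {ω | startTime ω.2 ≤ r} := by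
  have hcond := (admissible_iff.1 h).2
  rcases ht.2.lt_or_eq with htT | rfl
  · refine HasCondProb.iInf pathSigma_mono pathSigma_le fun s hs => ?_
    obtain ⟨u, htu, hu⟩ := exists_between (lt_min hs htT)
    obtain ⟨hus, huT⟩ := lt_min_iff.1 hu
    exact (hcond u ⟨ht.1.trans htu.le, huT.le⟩ _
      (measurableSet_startTime_le_of_lt (hr.trans_lt htu) huT.le)).mono
        (pathSigmaPlus_le_pathSigma hus)
  · exact hcond _ ht _ (measurableSet_startTime_le hr)

theorem Admissible.hasCondProb_startTime [IsFiniteMeasure P] (h : Admissible P₀ P) {t : ℝ}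
    (ht : t ∈ Icc 0 T) {R : Set ℝ} (hR : MeasurableSet[stopSigma t] R) :
    HasCondProb (pathSigmaPlus T _ t) Prod.fst P
      ((fun ω : PathPair d T => startTime ω.2) ⁻¹' R) := by
  have hR' : MeasurableSet[(stopSigma t).comap fun ω : PathPair d T => startTime ω.2]
      ((fun ω : PathPair d T => startTime ω.2) ⁻¹' R) := ⟨R, hR, rfl⟩
  rw [stopSigma, MeasurableSpace.comap_generateFrom, ← image_comp] at hR'
  refine HasCondProb.of_generateFrom (pathSigmaPlus_le t) measurable_fst ?_ ?_ ?_ hR'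
  · rintro _ ⟨r, hr, rfl⟩ _ ⟨r', -, rfl⟩ -
    exact ⟨min r r', (min_le_left r r').trans hr, by simp [← preimage_inter, Iic_inter_Iic]⟩
  · exact forall_mem_image.2 fun r _ => measurable_startTime_snd measurableSet_Iic
  · exact forall_mem_image.2 fun r hr => h.hasCondProb_startTime_le ht hr

/-- The law of `(L,A,σ)` where `(L,A)` has law `P` and `σ` is drawn, conditionally on `L`
independently of `A`, from the conditional law of the start time under `P'`. -/
def gluing (P P' : Measure (PathPair d T)) [IsFiniteMeasure P'] : Measure (PathPair d T × ℝ) :=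
  P ⊗ₘ (condDistrib (fun ω : PathPair d T => startTime ω.2) Prod.fst P').comap Prod.fst
    measurable_fst

section

variable [IsProbabilityMeasure P] [IsProbabilityMeasure P']

instance : IsProbabilityMeasure (gluing P P') := by
  unfold gluing
  infer_instance

theorem map_fst_gluing : (gluing P P').map Prod.fst = P := Measure.fst_compProd P _

theorem map_target_gluing (h : P.map Prod.fst = P'.map Prod.fst) :
    (gluing P P').map (fun p => (p.1.1, p.2)) = P'.map fun ω => (ω.1, startTime ω.2) := by
  rw [← compProd_map_condDistrib measurable_startTime_snd.aemeasurable, ← h]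
  refine Measure.ext_of_lintegral _ fun f hf => ?_
  rw [lintegral_map hf (by fun_prop), gluing, Measure.lintegral_compProd (by fun_prop),
    Measure.lintegral_compProd hf, lintegral_map (by fun_prop) measurable_fst]
  rfl

theorem hasCondProb_gluing (h : Admissible P₀ P) (h' : Admissible P₀ P') {t : ℝ}
    (ht : t ∈ Icc 0 T) {S : Set (PathPair d T × ℝ)}
    (hS : MeasurableSet[(sigmaA d T t).prod (stopSigma t)] S) :
    HasCondProb (pathSigmaPlus T _ t) (Prod.fst ∘ Prod.fst) (gluing P P') S := by
  have hgen : (sigmaA d T t).prod (stopSigma t) = _ :=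
    (@generateFrom_prod _ _ (sigmaA d T t) (stopSigma t)).symm
  rw [hgen] at hS
  refine HasCondProb.of_generateFrom (pathSigmaPlus_le t) (measurable_fst.comp measurable_fst)
    (@isPiSystem_prod _ _ (sigmaA d T t) (stopSigma t)) ?_ ?_ hS
  · rintro _ ⟨S, hS, R, hR, rfl⟩
    exact (sigmaA_le t _ hS).prod (stopSigma_le t _ hR)
  · rintro _ ⟨S, hS, R, hR, rfl⟩
    refine HasCondProb.compProd (pathSigmaPlus_le t) measurable_fst (sigmaA_le t _ hS)
      (stopSigma_le t _ hR) ((admissible_iff.1 h).2 t ht S hS) ?_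
    rw [h.marginal, ← h'.marginal]
    exact (h'.hasCondProb_startTime ht hR).condDistrib (pathSigmaPlus_le t) measurable_fst
      measurable_startTime_snd (stopSigma_le t _ hR)

theorem admissible_map_replaceMap_gluing (h : Admissible P₀ P) (h' : Admissible P₀ P')
    (ε : ℝ≥0) : Admissible P₀ ((gluing P P').map (replaceMap ε)) := by
  refine admissible_iff.2 ⟨?_, fun t ht S hS => ?_⟩
  · rw [Measure.map_map measurable_fst (measurable_replaceMap ε)]
    change (gluing P P').map (Prod.fst ∘ Prod.fst) = P₀
    rw [← Measure.map_map measurable_fst measurable_fst, map_fst_gluing, h.marginal]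
  · exact (hasCondProb_gluing h h' ht (measurable_replaceMap_sigmaA ε t hS)).map
      (measurable_replaceMap ε) measurable_fst (sigmaA_le t _ hS)

end

end Gluing

section ConvexCosts

theorem add_derivWithin_mul_sub_le {s : Set ℝ} {φ : ℝ → ℝ} (hc : ConvexOn ℝ s φ) {x y : ℝ}
    (hx : x ∈ s) (hy : y ∈ s) (hd : DifferentiableWithinAt ℝ φ s x) :
    φ x + derivWithin φ s x * (y - x) ≤ φ y := by
  have hderiv := hd.hasDerivWithinAt
  rcases lt_trichotomy x y with hxy | rfl | hyx
  · have hslope := hc.le_slope_of_hasDerivWithinAt hx hy hxy hderiv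
    rw [slope_def_field, le_div_iff₀ (sub_pos.2 hxy)] at hslope
    linarith
  · simp
  · have hslope := hc.slope_le_of_hasDerivWithinAt hy hx hyx hderiv
    rw [slope_def_field, div_le_iff₀ (sub_pos.2 hyx)] at hslope
    linarith

theorem le_exp_mul_of_abs_derivWithin_le {s : Set ℝ} (hs : Convex ℝ s) {ψ : ℝ → ℝ} {K : ℝ}
    (hd : DifferentiableOn ℝ ψ s) (hpos : ∀ x ∈ s, 0 < ψ x)
    (hK : ∀ x ∈ s, |derivWithin ψ s x| ≤ K * ψ x) {x y : ℝ} (hx : x ∈ s) (hy : y ∈ s) :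
    ψ y ≤ Real.exp (K * |y - x|) * ψ x := by
  have hlog : ‖Real.log (ψ y) - Real.log (ψ x)‖ ≤ K * ‖y - x‖ :=
    hs.norm_image_sub_le_of_norm_hasDerivWithin_le
      (fun z hz => (hd z hz).hasDerivWithinAt.log (hpos z hz).ne')
      (fun z hz => by
        rw [norm_div, Real.norm_of_nonneg (hpos z hz).le, div_le_iff₀ (hpos z hz)]
        exact hK z hz) hx hy
  have hle := (le_abs_self _).trans hlog
  rw [← Real.log_le_log_iff (hpos y hy) (mul_pos (Real.exp_pos _) (hpos x hx)),
    Real.log_mul (Real.exp_pos _).ne' (hpos x hx).ne', Real.log_exp]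
  exact sub_le_iff_le_add.1 hle

/-- The error, per unit of `ε`, in the first-order expansion of the cost `φ` when the bottom part,
of height `ε`, of a control with current value `a` is replaced by a jump. -/
def bottomError (φ : ℝ → ℝ) (ε a : ℝ) : ℝ :=
  (Iio ε).indicator (fun _ => |derivWithin φ (Ici 0) ε - derivWithin φ (Ici 0) 0|) a
    + (Ioo 0 ε).indicator (fun _ => |derivWithin φ (Ici 0) 0|) a

theorem bottomError_nonneg (φ : ℝ → ℝ) (ε a : ℝ) : 0 ≤ bottomError φ ε a :=
  add_nonneg (indicator_nonneg (fun _ _ => abs_nonneg _) _)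
    (indicator_nonneg (fun _ _ => abs_nonneg _) _)

theorem bottomError_of_le (φ : ℝ → ℝ) {ε a : ℝ} (h : ε ≤ a) : bottomError φ ε a = 0 := by
  simp [bottomError, h.not_gt]

theorem apply_max_sub_add_ite_le {φ : ℝ → ℝ} (hc : ConvexOn ℝ (Ici 0) φ)
    (hd : DifferentiableOn ℝ φ (Ici 0)) {a ε : ℝ} (ha : 0 ≤ a) (hε : 0 ≤ ε) (b : Prop)
    [Decidable b] :
    φ (max (a - ε) 0 + if b then ε else 0)
      ≤ φ a + ε * bottomError φ ε a
        + ε * ((if b then derivWithin φ (Ici 0) 0 else 0)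
          - if 0 < a then derivWithin φ (Ici 0) 0 else 0) := by
  have htangent {x y : ℝ} (hx : 0 ≤ x) (hy : 0 ≤ y) :=
    add_derivWithin_mul_sub_le hc hx hy (hd x hx)
  set D := derivWithin φ (Ici 0) with hD
  rcases le_or_gt ε a with hεa | haε
  · rw [bottomError_of_le φ hεa, max_eq_left (sub_nonneg.2 hεa)]
    rcases ha.eq_or_lt with rfl | hpos
    · simp [hεa.antisymm hε]
    have hmono : ε * D 0 ≤ ε * D (a - ε) := mul_le_mul_of_nonneg_left
      (hc.monotoneOn_derivWithin hd self_mem_Ici (sub_nonneg.2 hεa) (sub_nonneg.2 hεa)) hε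
    have hcut := htangent (sub_nonneg.2 hεa) ha
    rw [sub_sub_cancel] at hcut
    by_cases hb : b <;> simp only [hb, hpos, if_true, if_false, sub_add_cancel, add_zero] <;>
      linarith
  · rw [max_eq_right (sub_nonpos.2 haε.le), zero_add]
    have hjump := htangent hε ha
    have hcut := htangent le_rfl ha
    have hDε : ε * (D ε - D 0) ≤ ε * |D ε - D 0| :=
      mul_le_mul_of_nonneg_left (le_abs_self _) hε
    have hDε0 : 0 ≤ ε * |D ε - D 0| := mul_nonneg hε (abs_nonneg _)
    rcases ha.eq_or_lt with rfl | hpos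
    · have herror : bottomError φ ε 0 = |D ε - D 0| := by simp [bottomError, haε, hD]
      rw [herror]
      by_cases hb : b <;> simp only [hb, lt_irrefl, if_true, if_false] <;> linarith
    have herror : bottomError φ ε a = |D ε - D 0| + |D 0| := by
      simp [bottomError, haε, hpos, hD]
    have hscale {x y : ℝ} (hxy : x ≤ y) (hy : 0 ≤ y) : (ε - a) * x ≤ ε * y :=
      (mul_le_mul_of_nonneg_left hxy (sub_nonneg.2 haε.le)).trans
        (mul_le_mul_of_nonneg_right (sub_le_self ε ha) hy)
    rw [herror]
    by_cases hb : b <;> simp only [hb, hpos, if_true, if_false]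
    · linarith [hscale (x := D ε) (y := |D ε - D 0| + |D 0|)
        (by linarith [le_abs_self (D ε - D 0), le_abs_self (D 0)]) (by positivity)]
    · linarith [hscale (le_abs_self (D 0)) (abs_nonneg _)]

theorem tendsto_bottomError {φ : ℝ → ℝ} (hφ : ContDiffOn ℝ 1 φ (Ici 0)) {a : ℝ} (ha : 0 ≤ a) :
    Tendsto (fun ε => bottomError φ ε a) (𝓝[>] 0) (𝓝 0) := by
  rcases ha.eq_or_lt with rfl | ha'
  · have hcont : Tendsto (derivWithin φ (Ici 0)) (𝓝[>] 0) (𝓝 (derivWithin φ (Ici 0) 0)) :=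
      ((hφ.continuousOn_derivWithin (uniqueDiffOn_Ici 0) le_rfl) 0 self_mem_Ici).tendsto.mono_left
        (nhdsWithin_mono _ Ioi_subset_Ici_self)
    refine Tendsto.congr' ?_ (by simpa using (hcont.sub_const (derivWithin φ (Ici 0) 0)).abs)
    filter_upwards [self_mem_nhdsWithin] with ε hε
    simp [bottomError, mem_Ioi.1 hε]
  · refine tendsto_const_nhds.congr' ?_
    filter_upwards [nhdsWithin_le_nhds (Iio_mem_nhds ha')] with ε hε
    exact (bottomError_of_le φ (mem_Iio.1 hε).le).symm

variable {E : Type*} [MeasurableSpace E] {φ : E → ℝ → ℝ} {Φ : E → ℝ} {M : ℝ}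

/-- The standing assumptions on the running cost `h` and the terminal cost `g`. -/
structure IsConvexCost (φ : E → ℝ → ℝ) : Prop where
  nonneg : ∀ l a, 0 ≤ a → 0 ≤ φ l a
  measurable : Measurable fun p : E × Ici (0 : ℝ) => φ p.1 p.2
  convexOn : ∀ l, ConvexOn ℝ (Ici 0) (φ l)
  contDiffOn : ∀ l, ContDiffOn ℝ 1 (φ l) (Ici 0)

/-- The growth condition `|φ_a| ≤ Φ + M φ`, with `Φ` measurable and nonnegative. -/
structure HasGrowthBound (φ : E → ℝ → ℝ) (Φ : E → ℝ) (M : ℝ) : Prop where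
  measurable : Measurable Φ
  nonneg : ∀ l, 0 ≤ Φ l
  const_nonneg : 0 ≤ M
  abs_derivA_le : ∀ l a, 0 ≤ a → |derivA φ l a| ≤ Φ l + M * φ l a

namespace IsConvexCost

theorem differentiableOn (hφ : IsConvexCost φ) (l : E) : DifferentiableOn ℝ (φ l) (Ici 0) :=
  (hφ.contDiffOn l).differentiableOn one_ne_zero

theorem derivA_zero_le (hφ : IsConvexCost φ) (l : E) {a : ℝ} (ha : 0 ≤ a) :
    derivA φ l 0 ≤ derivA φ l a :=
  (hφ.convexOn l).monotoneOn_derivWithin (hφ.differentiableOn l) self_mem_Ici ha ha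

theorem measurable_comp (hφ : IsConvexCost φ) {α : Type*} [MeasurableSpace α] {l : α → E}
    {a : α → ℝ} (hl : Measurable l) (ha : Measurable a) (ha0 : ∀ x, 0 ≤ a x) :
    Measurable fun x => φ (l x) (a x) :=
  hφ.measurable.comp (hl.prodMk (ha.subtype_mk (h := ha0)))

theorem measurable_derivA (hφ : IsConvexCost φ) {a : ℝ} (ha : 0 ≤ a) :
    Measurable fun l => derivA φ l a := by
  have hpos (n : ℕ) : (0 : ℝ) < 1 / ((n : ℝ) + 1) := Nat.one_div_pos_of_nat
  have hstep (n : ℕ) : 0 ≤ a + 1 / ((n : ℝ) + 1) := add_nonneg ha (hpos n).le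
  refine measurable_of_tendsto_metrizable (f := fun (n : ℕ) (l : E) =>
    slope (φ l) a (a + 1 / ((n : ℝ) + 1))) (fun n => ?_) (tendsto_pi_nhds.2 fun l => ?_)
  · simp only [slope_def_field]
    exact ((hφ.measurable_comp measurable_id measurable_const fun _ => hstep n).sub
      (hφ.measurable_comp measurable_id measurable_const fun _ => ha)).div_const _
  · have hslope := hasDerivWithinAt_iff_tendsto_slope.1
      (hφ.differentiableOn l a ha).hasDerivWithinAt
    refine hslope.comp (tendsto_nhdsWithin_iff.2
      ⟨?_, .of_forall fun n => ⟨hstep n, by simpa using (hpos n).ne'⟩⟩)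
    simpa using tendsto_one_div_add_atTop_nhds_zero_nat.const_add a

theorem measurable_bottomError (hφ : IsConvexCost φ) {ε : ℝ} (hε : 0 ≤ ε) :
    Measurable fun p : E × ℝ => bottomError (φ p.1) ε p.2 := by
  have hD {a : ℝ} (ha : 0 ≤ a) : Measurable fun p : E × ℝ => derivA φ p.1 a :=
    (hφ.measurable_derivA ha).comp measurable_fst
  exact (((hD hε).sub (hD le_rfl)).abs.indicator (measurable_snd measurableSet_Iio)).add
    ((hD le_rfl).abs.indicator (measurable_snd measurableSet_Ioo))

end IsConvexCost

theorem HasGrowthBound.abs_derivA_le_exp_mul (hΦ : HasGrowthBound φ Φ M) (hφ : IsConvexCost φ)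
    (l : E) {a b : ℝ} (ha : 0 ≤ a) (hb : 0 ≤ b) :
    |derivA φ l b| ≤ (M + 1) * (Real.exp ((M + 1) * |b - a|) * (φ l a + Φ l + 1)) := by
  have hbound (x : ℝ) (hx : x ∈ Ici 0) :
      |derivWithin (fun x => φ l x + (Φ l + 1)) (Ici 0) x| ≤ (M + 1) * (φ l x + (Φ l + 1)) := by
    rw [derivWithin_add_const]
    refine (hΦ.abs_derivA_le l x hx).trans ?_
    nlinarith [hφ.nonneg l x hx, hΦ.nonneg l, mul_nonneg hΦ.const_nonneg (hΦ.nonneg l),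
      hΦ.const_nonneg]
  have hpos (x : ℝ) (hx : x ∈ Ici 0) : 0 < φ l x + (Φ l + 1) := by
    linarith [hφ.nonneg l x hx, hΦ.nonneg l]
  have hexp := le_exp_mul_of_abs_derivWithin_le (convex_Ici 0)
    ((hφ.differentiableOn l).add_const _) hpos hbound ha hb
  have hderiv := hbound b hb
  rw [derivWithin_add_const] at hderiv
  rw [add_assoc]
  exact hderiv.trans (mul_le_mul_of_nonneg_left hexp (by linarith [hΦ.const_nonneg]))

theorem HasGrowthBound.bottomError_le (hΦ : HasGrowthBound φ Φ M) (hφ : IsConvexCost φ) (l : E)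
    {a ε : ℝ} (ha : 0 ≤ a) (hε : ε ∈ Icc 0 1) :
    bottomError (φ l) ε a ≤ 3 * (M + 1) * Real.exp (M + 1) * (φ l a + Φ l + 1) := by
  have hM := hΦ.const_nonneg
  have hpos : 0 ≤ φ l a + Φ l + 1 := by linarith [hφ.nonneg l a ha, hΦ.nonneg l]
  rcases le_or_gt ε a with hεa | haε
  · rw [bottomError_of_le _ hεa]
    positivity
  have hD {b : ℝ} (hb : b ∈ Icc 0 ε) :
      |derivA φ l b| ≤ (M + 1) * (Real.exp (M + 1) * (φ l a + Φ l + 1)) := by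
    refine (hΦ.abs_derivA_le_exp_mul hφ l ha hb.1).trans ?_
    have hdist : |b - a| ≤ 1 := abs_le.2 ⟨by linarith [hb.1, hε.2], by linarith [hb.2, hε.2]⟩
    gcongr
    exact mul_le_of_le_one_right (by linarith) hdist
  have hle : bottomError (φ l) ε a ≤ |derivA φ l ε - derivA φ l 0| + |derivA φ l 0| :=
    add_le_add (indicator_le_self' (fun _ _ => abs_nonneg _) a)
      (indicator_le_self' (fun _ _ => abs_nonneg _) a)
  linarith [abs_sub (derivA φ l ε) (derivA φ l 0), hD ⟨le_rfl, hε.1⟩, hD ⟨hε.1, le_rfl⟩]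

theorem HasGrowthBound.ofReal_derivA_zero_le (hΦ : HasGrowthBound φ Φ M) (hφ : IsConvexCost φ)
    (l : E) {a : ℝ} (ha : 0 ≤ a) :
    ENNReal.ofReal (derivA φ l 0)
      ≤ ENNReal.ofReal (Φ l) + ENNReal.ofReal M * ENNReal.ofReal (φ l a) := by
  rw [← ENNReal.ofReal_mul hΦ.const_nonneg,
    ← ENNReal.ofReal_add (hΦ.nonneg l) (mul_nonneg hΦ.const_nonneg (hφ.nonneg l a ha))]
  exact ENNReal.ofReal_le_ofReal
    ((hφ.derivA_zero_le l ha).trans ((le_abs_self _).trans (hΦ.abs_derivA_le l a ha)))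

end ConvexCosts

section Expansion

theorem coe_le_coe_add_sub_iff {x y : ℝ≥0∞} {u v : ℝ} :
    (x : EReal) ≤ y + ((u - v : ℝ) : EReal) ↔
      x + ENNReal.ofReal v + ENNReal.ofReal (-u) ≤ y + ENNReal.ofReal u + ENNReal.ofReal (-v) := by
  have hsub (r : ℝ) : (r.toNNReal : ℝ) - ((-r).toNNReal : ℝ) = r := by
    simp only [Real.coe_toNNReal', max_zero_sub_max_neg_zero_eq_self]
  induction y with
  | top => simp only [EReal.coe_ennreal_top, EReal.top_add_coe, le_top, top_add]
  | coe y =>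
    induction x with
    | top =>
      simp only [ENNReal.ofReal, EReal.coe_ennreal_top, EReal.coe_nnreal_eq_coe_real,
        ← EReal.coe_add, ← ENNReal.coe_add, top_le_iff, EReal.coe_ne_top, ENNReal.coe_ne_top,
        top_add]
    | coe x =>
      simp only [ENNReal.ofReal, ← ENNReal.coe_add, ENNReal.coe_le_coe, ← NNReal.coe_le_coe,
        NNReal.coe_add, EReal.coe_nnreal_eq_coe_real, ← EReal.coe_add, EReal.coe_le_coe_iff]
      constructor <;> intro h <;> linarith [hsub u, hsub v]

theorem coe_lintegral_ofReal_le_add_integral {α : Type*} [MeasurableSpace α] {μ : Measure α}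
    {a b z : α → ℝ} (ha : ∀ᵐ x ∂μ, 0 ≤ a x) (hz : Integrable z μ) (h : ∀ᵐ x ∂μ, a x ≤ b x + z x) :
    ((∫⁻ x, ENNReal.ofReal (a x) ∂μ : ℝ≥0∞) : EReal)
      ≤ (∫⁻ x, ENNReal.ofReal (b x) ∂μ : ℝ≥0∞) + ((∫ x, z x ∂μ : ℝ) : EReal) := by
  have hpos : ∫⁻ x, ENNReal.ofReal (z x) ∂μ ≠ ∞ := hz.lintegral_lt_top.ne
  have hneg : ∫⁻ x, ENNReal.ofReal (-z x) ∂μ ≠ ∞ := hz.neg.lintegral_lt_top.ne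
  rw [integral_eq_lintegral_pos_part_sub_lintegral_neg_part hz, coe_le_coe_add_sub_iff,
    ENNReal.ofReal_toReal hpos, ENNReal.ofReal_toReal hneg,
    ENNReal.ofReal_of_nonpos (neg_nonpos.2 ENNReal.toReal_nonneg),
    ENNReal.ofReal_of_nonpos (neg_nonpos.2 ENNReal.toReal_nonneg), add_zero, add_zero,
    ← lintegral_add_right' _ (by exact hz.aemeasurable.neg.ennreal_ofReal),
    ← lintegral_add_right' _ hz.aemeasurable.ennreal_ofReal]
  refine lintegral_mono_ae ?_
  filter_upwards [ha, h] with x hax hx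
  rcases le_total 0 (z x) with hzx | hzx
  · rw [ENNReal.ofReal_of_nonpos (neg_nonpos.2 hzx), add_zero]
    exact (ENNReal.ofReal_le_ofReal hx).trans ENNReal.ofReal_add_le
  · rw [ENNReal.ofReal_of_nonpos hzx, add_zero, ← ENNReal.ofReal_add hax (neg_nonneg.2 hzx)]
    exact ENNReal.ofReal_le_ofReal (by linarith)

variable {T : ℝ} [hT : Fact (0 < T)]

/-- Measures on `[0,T]` which do not distinguish the start time `inf {t | 0 < A t}` from the set
of times at which `A` is positive. They integrate the cost of a state `(L t, A t)` over time: the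
Lebesgue measure for the running cost, and the unit mass at `T` for the terminal cost. -/
structure IsTimeWeight (T : ℝ) [Fact (0 < T)] (μ : Measure ℝ) : Prop where
  ae_mem_Icc : ∀ᵐ t ∂μ, t ∈ Icc 0 T
  ae_startTime_le_iff_pos (A : IncreasingPath T) : ∀ᵐ t ∂μ, startTime A ≤ t ↔ 0 < A t

theorem isTimeWeight_dirac : IsTimeWeight T (Measure.dirac T) where
  ae_mem_Icc := (ae_dirac_iff measurableSet_Icc).2 ⟨hT.out.le, le_rfl⟩
  ae_startTime_le_iff_pos A := by
    rw [ae_dirac_eq]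
    exact startTime_le_iff_pos ⟨le_rfl, lt_add_one T⟩

theorem isTimeWeight_volume : IsTimeWeight T (volume.restrict (Icc 0 T)) where
  ae_mem_Icc := ae_restrict_mem measurableSet_Icc
  ae_startTime_le_iff_pos := ae_startTime_le_iff_pos

variable {E : Type*} [TopologicalSpace E]

/-- The cost `∫ φ(L_t, A_t) μ(dt)`. -/
def pathCost (φ : E → ℝ → ℝ) (μ : Measure ℝ) (ω : CadlagPath T E × IncreasingPath T) : ℝ≥0∞ :=
  ∫⁻ t, ENNReal.ofReal (φ (ω.1 t) (ω.2 t)) ∂μ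

/-- The error of the first-order expansion of `pathCost`, per unit of `ε`. -/
def pathError (φ : E → ℝ → ℝ) (μ : Measure ℝ) (ε : ℝ) (ω : CadlagPath T E × IncreasingPath T) :
    ℝ≥0∞ :=
  ∫⁻ t, ENNReal.ofReal (bottomError (φ (ω.1 t)) ε (ω.2 t)) ∂μ

/-- The marginal cost `∫_{[s,∞)} φ_a(L_t, 0) μ(dt)` of raising the zero control at time `s`. -/
def marginalCost (φ : E → ℝ → ℝ) (μ : Measure ℝ) (L : CadlagPath T E) (s : ℝ) : ℝ :=
  ∫ t in Ici s, derivA φ (L t) 0 ∂μ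

variable {φ : E → ℝ → ℝ} {μ : Measure ℝ}

section Measurability

variable [MeasurableSpace E]

theorem measurable_snd_eval :
    Measurable fun p : (CadlagPath T E × IncreasingPath T) × ℝ => p.1.2 p.2 :=
  IncreasingPath.measurable_eval_uncurry.comp (measurable_snd.prodMap measurable_id)

variable [TopologicalSpace.PseudoMetrizableSpace E] [BorelSpace E]
  [SFinite μ]

theorem measurable_fst_eval :
    Measurable fun p : (CadlagPath T E × IncreasingPath T) × ℝ => p.1.1 p.2 :=
  CadlagPath.measurable_eval_uncurry.comp (measurable_fst.prodMap measurable_id)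

theorem IsConvexCost.measurable_eval (hφ : IsConvexCost φ) :
    Measurable fun p : (CadlagPath T E × IncreasingPath T) × ℝ => φ (p.1.1 p.2) (p.1.2 p.2) :=
  hφ.measurable_comp measurable_fst_eval measurable_snd_eval fun p => p.1.2.eval_nonneg _

theorem IsConvexCost.measurable_bottomError_eval (hφ : IsConvexCost φ) {ε : ℝ} (hε : 0 ≤ ε) :
    Measurable fun p : (CadlagPath T E × IncreasingPath T) × ℝ =>
      bottomError (φ (p.1.1 p.2)) ε (p.1.2 p.2) :=
  (hφ.measurable_bottomError hε).comp (measurable_fst_eval.prodMk measurable_snd_eval)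

theorem measurable_pathCost (hφ : IsConvexCost φ) :
    Measurable (pathCost (T := T) φ μ) :=
  hφ.measurable_eval.ennreal_ofReal.lintegral_prod_right'

theorem measurable_pathError (hφ : IsConvexCost φ) {ε : ℝ} (hε : 0 ≤ ε) :
    Measurable (pathError (T := T) φ μ ε) :=
  (hφ.measurable_bottomError_eval hε).ennreal_ofReal.lintegral_prod_right'

theorem measurable_marginalCost (hφ : IsConvexCost φ) :
    Measurable fun p : CadlagPath T E × ℝ => marginalCost φ μ p.1 p.2 := by
  simp only [marginalCost, ← integral_indicator measurableSet_Ici]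
  have hD : Measurable fun q : (CadlagPath T E × ℝ) × ℝ => derivA φ (q.1.1 q.2) 0 :=
    (hφ.measurable_derivA le_rfl).comp
      (CadlagPath.measurable_eval_uncurry.comp (measurable_fst.prodMap measurable_id))
  have hset : MeasurableSet {q : (CadlagPath T E × ℝ) × ℝ | q.1.2 ≤ q.2} :=
    measurableSet_le (measurable_snd.comp measurable_fst) measurable_snd
  exact (hD.indicator hset).stronglyMeasurable.integral_prod_right'.measurable

end Measurability

theorem pathCost_replaceBottom_le [TopologicalSpace.PseudoMetrizableSpace E] [MeasurableSpace E]
    [BorelSpace E] (hφ : IsConvexCost φ) (hμ : IsTimeWeight T μ) (L : CadlagPath T E)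
    (A : IncreasingPath T) (ε : ℝ≥0) (s : ℝ)
    (hD : Integrable (fun t => derivA φ (L t) 0) μ) :
    (pathCost φ μ (L, A.replaceBottom ε s) : EReal)
      ≤ (pathCost φ μ (L, A) + ε * pathError φ μ ε (L, A) : ℝ≥0∞)
        + ((ε * marginalCost φ μ L s - ε * marginalCost φ μ L (startTime A) : ℝ) : EReal) := by
  have hjump (r : ℝ) := hD.indicator (measurableSet_Ici (a := r))
  have hpointwise : ∀ᵐ t ∂μ, φ (L t) (A.replaceBottom ε s t)
      ≤ (φ (L t) (A t) + ε * bottomError (φ (L t)) ε (A t))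
        + ε * ((Ici s).indicator (fun t => derivA φ (L t) 0) t
          - (Ici (startTime A)).indicator (fun t => derivA φ (L t) 0) t) := by
    filter_upwards [hμ.ae_mem_Icc, hμ.ae_startTime_le_iff_pos A] with t ht hpos
    rw [A.replaceBottom_eval ε s ht]
    simp only [indicator_apply, mem_Ici, hpos]
    exact apply_max_sub_add_ite_le (hφ.convexOn _) (hφ.differentiableOn _) (A.eval_nonneg t)
      ε.coe_nonneg (s ≤ t)
  have hle := coe_lintegral_ofReal_le_add_integral
    (.of_forall fun t => hφ.nonneg _ _ ((A.replaceBottom ε s).eval_nonneg t))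
    (((hjump s).sub (hjump (startTime A))).const_mul (ε : ℝ)) hpointwise
  have hmeas : Measurable fun t => φ (L t) (A t) :=
    hφ.measurable_eval.comp (measurable_prodMk_left (x := (L, A)))
  have hexpand : ∫⁻ t, ENNReal.ofReal (φ (L t) (A t) + ε * bottomError (φ (L t)) ε (A t)) ∂μ
      = pathCost φ μ (L, A) + ε * pathError φ μ ε (L, A) := by
    simp only [ENNReal.ofReal_add (hφ.nonneg _ _ (A.eval_nonneg _))
      (mul_nonneg ε.coe_nonneg (bottomError_nonneg _ _ _)), ENNReal.ofReal_mul ε.coe_nonneg,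
      ENNReal.ofReal_coe_nnreal]
    rw [lintegral_add_left hmeas.ennreal_ofReal, lintegral_const_mul' _ _ ENNReal.coe_ne_top]
    rfl
  rwa [hexpand, integral_const_mul, integral_sub' (hjump s) (hjump _),
    integral_indicator measurableSet_Ici, integral_indicator measurableSet_Ici, mul_sub] at hle

end Expansion

section TimeCost

variable {T : ℝ} [hT : Fact (0 < T)] {f : ℝ → ℝ≥0∞}

theorem IncreasingPath.stieltjes_measure_bottom_Icc_startTime (A : IncreasingPath T) {ε : ℝ≥0}
    {u : ℝ} (hτ : startTime A ≤ u) (hu : u ≤ T) (hε : ε ≤ A u) :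
    (A.bottom ε).stieltjes.measure (Icc (startTime A) u) = ε := by
  have hleft : Function.leftLim (A.bottom ε).stieltjes (startTime A) = 0 := by
    refine leftLim_eq_of_tendsto (tendsto_const_nhds.congr' ?_)
    filter_upwards [self_mem_nhdsWithin] with t ht
    change 0 = if t < 0 then 0 else A.bottom ε t
    split_ifs with h0
    · rfl
    have hA : A t = 0 := (A.eval_nonneg t).antisymm' <| not_lt.1 fun hpos =>
      (mem_Iio.1 ht).not_ge (startTime_le_of_pos ⟨not_lt.1 h0, (mem_Iio.1 ht).le.trans
        (hτ.trans hu)⟩ hpos)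
    rw [bottom_eval, hA, min_eq_left ε.coe_nonneg]
  have hright : (A.bottom ε).stieltjes u = ε :=
    (if_neg ((startTime_nonneg A).trans hτ).not_gt).trans (min_eq_right hε)
  rw [StieltjesFunction.measure_Icc, hleft, hright, sub_zero, ENNReal.ofReal_coe_nnreal]

/-- The integral `∫ f dA`, where the initial value of `A` counts as a jump at time `0`. -/
def controlCost (f : ℝ → ℝ≥0∞) (A : IncreasingPath T) : ℝ≥0∞ :=
  ∫⁻ t, f t ∂A.stieltjes.measure

/-- The error, per unit of `ε`, in the first-order expansion of `controlCost`: the bottom part of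
`A`, of height `ε`, costs about `ε f(τ_A)`. -/
def controlError (f : ℝ → ℝ≥0∞) (ε : ℝ≥0) (A : IncreasingPath T) : ℝ≥0∞ :=
  f (startTime A) - (ε : ℝ≥0∞)⁻¹ * controlCost f (A.bottom ε)

theorem controlError_le (f : ℝ → ℝ≥0∞) (ε : ℝ≥0) (A : IncreasingPath T) :
    controlError f ε A ≤ f (startTime A) :=
  tsub_le_self

theorem measurable_controlCost (hf : Measurable f) : Measurable (controlCost (T := T) f) :=
  (Measure.measurable_lintegral hf).comp IncreasingPath.measurable_stieltjes_measure

theorem measurable_controlError_snd {d : ℕ} (hf : Measurable f) (ε : ℝ≥0) :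
    Measurable fun ω : PathPair d T => controlError f ε ω.2 :=
  (hf.comp measurable_startTime_snd).sub <| ((measurable_controlCost hf).comp
    ((IncreasingPath.measurable_bottom ε).comp measurable_snd)).const_mul _

theorem controlCost_replaceBottom_add_le (hf : Measurable f) (hfT : ∀ t, T < t → f t = 0)
    (A : IncreasingPath T) {ε : ℝ≥0} (hε : 0 < ε) {s : ℝ} (hs : 0 ≤ s) :
    controlCost f (A.replaceBottom ε s) + ε * f (startTime A)
      ≤ controlCost f A + ε * controlError f ε A + ε * f s := by
  have hdirac : ∫⁻ t, f t ∂(Measure.dirac s).restrict (Iic T) = f s := by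
    have hsupp : Function.support f ⊆ Iic T := fun t ht => not_lt.1 fun h => ht (hfT t h)
    rw [setLIntegral_eq_of_support_subset hsupp, lintegral_dirac' s hf]
  have hbalance : controlCost f (A.replaceBottom ε s) + controlCost f (A.bottom ε)
      = controlCost f A + ε * f s := by
    simp only [controlCost]
    rw [← lintegral_add_measure, A.stieltjes_measure_replaceBottom_add_bottom ε hs,
      lintegral_add_measure, lintegral_smul_measure, hdirac, smul_eq_mul]
  have hstart : ε * f (startTime A) ≤ ε * controlError f ε A + controlCost f (A.bottom ε) := by
    calc ε * f (startTime A)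
        ≤ ε * (controlError f ε A + (ε : ℝ≥0∞)⁻¹ * controlCost f (A.bottom ε)) := by
          gcongr
          exact le_tsub_add
      _ = ε * controlError f ε A + controlCost f (A.bottom ε) := by
          rw [mul_add, ENNReal.mul_inv_cancel_left (by exact_mod_cast hε.ne') ENNReal.coe_ne_top]
  calc controlCost f (A.replaceBottom ε s) + ε * f (startTime A)
      ≤ controlCost f (A.replaceBottom ε s)
        + (ε * controlError f ε A + controlCost f (A.bottom ε)) := by gcongr
    _ = controlCost f A + ε * controlError f ε A + ε * f s := by
        rw [add_left_comm, hbalance, add_left_comm, ← add_assoc]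

theorem eventually_mul_le_controlCost_bottom (hf : ContinuousOn f (Icc 0 T))
    {A : IncreasingPath T} (hτ : startTime A ≤ T) {y : ℝ≥0∞} (hy : y < f (startTime A)) :
    ∀ᶠ ε : ℝ≥0 in 𝓝[>] 0, y * ε ≤ controlCost f (A.bottom ε) := by
  obtain ⟨u, hτu, huT, hAu, hfu⟩ : ∃ u, startTime A ≤ u ∧ u ≤ T ∧ 0 < A u ∧
      ∀ t ∈ Icc (startTime A) u, y ≤ f t := by
    rcases hτ.eq_or_lt with heq | hlt
    · refine ⟨T, hτ, le_rfl, (startTime_le_iff_pos ⟨le_rfl, lt_add_one T⟩).1 hτ, fun t ht => ?_⟩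
      rw [(ht.2.trans heq.ge).antisymm ht.1]
      exact hy.le
    · have hnear : {t | y < f t} ∈ 𝓝[≥] startTime A :=
        ((hf _ ⟨startTime_nonneg A, hτ⟩).mono_of_mem_nhdsWithin (mem_of_superset
          (Icc_mem_nhdsGE hlt) (Icc_subset_Icc_left (startTime_nonneg A)))) (lt_mem_nhds hy)
      obtain ⟨u, ⟨hτu, huT⟩, hfu⟩ := (mem_nhdsGE_iff_exists_mem_Ioc_Ico_subset hlt).1 hnear
      obtain ⟨v, hτv, hvu⟩ := exists_between hτu
      exact ⟨v, hτv.le, hvu.le.trans huT, pos_of_startTime_lt (by linarith) hτv,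
        fun t ht => (hfu ⟨ht.1, ht.2.trans_lt hvu⟩).le⟩
  have hsmall : ∀ᶠ ε : ℝ≥0 in 𝓝[>] 0, (ε : ℝ) ≤ A u := nhdsWithin_le_nhds
    (NNReal.continuous_coe.continuousAt.eventually (Iic_mem_nhds hAu))
  filter_upwards [hsmall] with ε hε
  calc y * ε = ∫⁻ _ in Icc (startTime A) u, y ∂(A.bottom ε).stieltjes.measure := by
        rw [setLIntegral_const, A.stieltjes_measure_bottom_Icc_startTime hτu huT hε]
    _ ≤ ∫⁻ t in Icc (startTime A) u, f t ∂(A.bottom ε).stieltjes.measure :=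
        setLIntegral_mono' measurableSet_Icc hfu
    _ ≤ controlCost f (A.bottom ε) := setLIntegral_le_lintegral _ _

theorem tendsto_controlError (hf : ContinuousOn f (Icc 0 T)) (hfT : ∀ t, T < t → f t = 0)
    (hfin : ∀ t, f t ≠ ∞) (A : IncreasingPath T) :
    Tendsto (fun ε => controlError f ε A) (𝓝[>] 0) (𝓝 0) := by
  rcases eq_or_ne (f (startTime A)) 0 with h0 | h0
  · simp only [controlError, h0, zero_tsub, tendsto_const_nhds]
  have hτ : startTime A ≤ T := not_lt.1 fun h => h0 (hfT _ h)
  refine ENNReal.tendsto_nhds_zero.2 fun r hr => ?_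
  filter_upwards [eventually_mul_le_controlCost_bottom hf hτ
    (ENNReal.sub_lt_self (hfin _) h0 hr.ne'), self_mem_nhdsWithin] with ε hle hε
  have hε' : (ε : ℝ≥0∞) ≠ 0 := by exact_mod_cast (mem_Ioi.1 hε).ne'
  rw [controlError, tsub_le_iff_left, ← tsub_le_iff_right, mul_comm, ← div_eq_mul_inv]
  exact (ENNReal.le_div_iff_mul_le (.inl hε') (.inl ENNReal.coe_ne_top)).2 hle

end TimeCost

section Integrability

theorem ofReal_integral_le_lintegral_ofReal {α : Type*} [MeasurableSpace α] {μ : Measure α}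
    (f : α → ℝ) : ENNReal.ofReal (∫ x, f x ∂μ) ≤ ∫⁻ x, ENNReal.ofReal (f x) ∂μ := by
  by_cases hf : Integrable f μ
  · rw [integral_eq_lintegral_pos_part_sub_lintegral_neg_part hf]
    exact (ENNReal.ofReal_le_ofReal (sub_le_self _ ENNReal.toReal_nonneg)).trans
      ENNReal.ofReal_toReal_le
  · simp only [integral_undef hf, ENNReal.ofReal_zero, zero_le]

variable {T : ℝ} [hT : Fact (0 < T)] {E : Type*} [TopologicalSpace E] {φ : E → ℝ → ℝ}
  {μ : Measure ℝ}

theorem ofReal_marginalCost_le (L : CadlagPath T E) (s : ℝ) :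
    ENNReal.ofReal (marginalCost φ μ L s) ≤ ∫⁻ t, ENNReal.ofReal (derivA φ (L t) 0) ∂μ :=
  (ofReal_integral_le_lintegral_ofReal _).trans (setLIntegral_le_lintegral _ _)

variable [TopologicalSpace.PseudoMetrizableSpace E] [MeasurableSpace E] [BorelSpace E]
  {Φ : E → ℝ} {M : ℝ}

theorem IsConvexCost.measurable_lintegral_ofReal_derivA_zero [SFinite μ] (hφ : IsConvexCost φ) :
    Measurable fun L : CadlagPath T E => ∫⁻ t, ENNReal.ofReal (derivA φ (L t) 0) ∂μ :=
  ((hφ.measurable_derivA le_rfl).comp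
    CadlagPath.measurable_eval_uncurry).ennreal_ofReal.lintegral_prod_right'

theorem HasGrowthBound.lintegral_ofReal_derivA_zero_le (hΦ : HasGrowthBound φ Φ M)
    (hφ : IsConvexCost φ) (ω : CadlagPath T E × IncreasingPath T) :
    ∫⁻ t, ENNReal.ofReal (derivA φ (ω.1 t) 0) ∂μ
      ≤ (∫⁻ t, ENNReal.ofReal (Φ (ω.1 t)) ∂μ) + ENNReal.ofReal M * pathCost φ μ ω := by
  refine (lintegral_mono fun t => hΦ.ofReal_derivA_zero_le hφ _ (ω.2.eval_nonneg t)).trans_eq ?_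
  have hmeas : Measurable fun t => ENNReal.ofReal (Φ (ω.1 t)) :=
    (hΦ.measurable.comp ω.1.measurable_apply).ennreal_ofReal
  rw [lintegral_add_left hmeas,
    lintegral_const_mul' _ _ ENNReal.ofReal_ne_top]
  rfl

theorem HasGrowthBound.integrable_derivA_zero [IsFiniteMeasure μ] (hΦ : HasGrowthBound φ Φ M)
    (hφ : IsConvexCost φ) {ω : CadlagPath T E × IncreasingPath T} (hω : pathCost φ μ ω < ∞)
    (hΦω : ∫⁻ t, ENNReal.ofReal (Φ (ω.1 t)) ∂μ < ∞) :
    Integrable (fun t => derivA φ (ω.1 t) 0) μ := by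
  have hcost : Integrable (fun t => φ (ω.1 t) (ω.2 t)) μ :=
    ⟨(hφ.measurable_eval.comp measurable_prodMk_left).aestronglyMeasurable,
      (hasFiniteIntegral_iff_ofReal (.of_forall fun t => hφ.nonneg _ _ (ω.2.eval_nonneg t))).2 hω⟩
  have hbound : Integrable (fun t => Φ (ω.1 t)) μ :=
    ⟨(hΦ.measurable.comp ω.1.measurable_apply).aestronglyMeasurable,
      (hasFiniteIntegral_iff_ofReal (.of_forall fun t => hΦ.nonneg _)).2 hΦω⟩
  refine ((((hcost.add hbound).add (integrable_const 1)).const_mul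
    (Real.exp ((M + 1) * ω.2 T))).const_mul (M + 1)).mono'
    ((hφ.measurable_derivA le_rfl).comp ω.1.measurable_apply).aestronglyMeasurable
    (.of_forall fun t => ?_)
  have hM := hΦ.const_nonneg
  have hdist : |0 - ω.2 t| ≤ ω.2 T := by
    rw [zero_sub, abs_neg, abs_of_nonneg (ω.2.eval_nonneg t)]
    exact ω.2.eval_le t
  refine (hΦ.abs_derivA_le_exp_mul hφ _ (ω.2.eval_nonneg t) le_rfl).trans ?_
  have hpos : 0 ≤ φ (ω.1 t) (ω.2 t) + Φ (ω.1 t) + 1 := by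
    linarith [hφ.nonneg (ω.1 t) _ (ω.2.eval_nonneg t), hΦ.nonneg (ω.1 t)]
  simp only [Pi.add_apply]
  gcongr

theorem HasGrowthBound.lintegral_eval_lt_top [SFinite μ] (hΦ : HasGrowthBound φ Φ M)
    {Q : Measure (CadlagPath T E × IncreasingPath T)}
    (hQ : ∫⁻ L, (∫⁻ t, ENNReal.ofReal (Φ (L t)) ∂μ) ∂(Q.map Prod.fst) < ∞) :
    ∫⁻ ω, (∫⁻ t, ENNReal.ofReal (Φ (ω.1 t)) ∂μ) ∂Q < ∞ := by
  have hmeas : Measurable fun L : CadlagPath T E => ∫⁻ t, ENNReal.ofReal (Φ (L t)) ∂μ :=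
    (hΦ.measurable.comp
      CadlagPath.measurable_eval_uncurry).ennreal_ofReal.lintegral_prod_right'
  rwa [lintegral_map hmeas measurable_fst] at hQ

variable [IsFiniteMeasure μ] {Q : Measure (CadlagPath T E × IncreasingPath T)}

theorem HasGrowthBound.lintegral_lintegral_ofReal_derivA_zero_lt_top (hΦ : HasGrowthBound φ Φ M)
    (hφ : IsConvexCost φ) (hcost : ∫⁻ ω, pathCost φ μ ω ∂Q < ∞)
    (hQ : ∫⁻ L, (∫⁻ t, ENNReal.ofReal (Φ (L t)) ∂μ) ∂(Q.map Prod.fst) < ∞) :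
    ∫⁻ L, (∫⁻ t, ENNReal.ofReal (derivA φ (L t) 0) ∂μ) ∂(Q.map Prod.fst) < ∞ := by
  rw [lintegral_map hφ.measurable_lintegral_ofReal_derivA_zero measurable_fst]
  refine (lintegral_mono fun ω => hΦ.lintegral_ofReal_derivA_zero_le hφ ω).trans_lt ?_
  rw [lintegral_add_right _ ((measurable_pathCost hφ).const_mul _),
    lintegral_const_mul _ (measurable_pathCost hφ)]
  exact ENNReal.add_lt_top.2 ⟨hΦ.lintegral_eval_lt_top hQ,
    ENNReal.mul_lt_top ENNReal.ofReal_lt_top hcost⟩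

theorem HasGrowthBound.ae_integrable_derivA_zero (hΦ : HasGrowthBound φ Φ M)
    (hφ : IsConvexCost φ) (hcost : ∫⁻ ω, pathCost φ μ ω ∂Q < ∞)
    (hQ : ∫⁻ L, (∫⁻ t, ENNReal.ofReal (Φ (L t)) ∂μ) ∂(Q.map Prod.fst) < ∞) :
    ∀ᵐ L ∂(Q.map Prod.fst), Integrable (fun t => derivA φ (L t) 0) μ := by
  have hD : Measurable fun p : CadlagPath T E × ℝ => derivA φ (p.1 p.2) 0 :=
    (hφ.measurable_derivA le_rfl).comp CadlagPath.measurable_eval_uncurry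
  have hset : MeasurableSet {L : CadlagPath T E | Integrable (fun t => derivA φ (L t) 0) μ} :=
    measurableSet_integrable hD.stronglyMeasurable
  rw [ae_map_iff measurable_fst.aemeasurable hset]
  filter_upwards [ae_lt_top (measurable_pathCost hφ) hcost.ne, ae_lt_top
    ((hΦ.measurable.comp measurable_fst_eval).ennreal_ofReal.lintegral_prod_right')
    (hΦ.lintegral_eval_lt_top hQ).ne] with ω hω hΦω
  exact hΦ.integrable_derivA_zero hφ hω hΦω

theorem HasGrowthBound.lintegral_prod_lt_top [IsFiniteMeasure Q] (hΦ : HasGrowthBound φ Φ M)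
    (hφ : IsConvexCost φ) (hcost : ∫⁻ ω, pathCost φ μ ω ∂Q < ∞)
    (hQ : ∫⁻ L, (∫⁻ t, ENNReal.ofReal (Φ (L t)) ∂μ) ∂(Q.map Prod.fst) < ∞) :
    ∫⁻ p, (ENNReal.ofReal (φ (p.1.1 p.2) (p.1.2 p.2)) + ENNReal.ofReal (Φ (p.1.1 p.2)) + 1)
      ∂(Q.prod μ) < ∞ := by
  have hφm := (hφ.measurable_eval (T := T)).ennreal_ofReal
  have hΦm : Measurable fun p : (CadlagPath T E × IncreasingPath T) × ℝ =>
      ENNReal.ofReal (Φ (p.1.1 p.2)) := (hΦ.measurable.comp measurable_fst_eval).ennreal_ofReal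
  rw [lintegral_add_right _ measurable_const, lintegral_add_left hφm, lintegral_one,
    lintegral_prod _ hφm.aemeasurable, lintegral_prod _ hΦm.aemeasurable]
  exact ENNReal.add_lt_top.2 ⟨ENNReal.add_lt_top.2 ⟨hcost, hΦ.lintegral_eval_lt_top hQ⟩,
    measure_lt_top _ _⟩

theorem HasGrowthBound.tendsto_lintegral_pathError [IsFiniteMeasure Q]
    (hΦ : HasGrowthBound φ Φ M) (hφ : IsConvexCost φ) (hcost : ∫⁻ ω, pathCost φ μ ω ∂Q < ∞)
    (hQ : ∫⁻ L, (∫⁻ t, ENNReal.ofReal (Φ (L t)) ∂μ) ∂(Q.map Prod.fst) < ∞) :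
    Tendsto (fun ε : ℝ≥0 => ∫⁻ ω, pathError φ μ ε ω ∂Q) (𝓝[>] 0) (𝓝 0) := by
  have herror (ε : ℝ≥0) := (hφ.measurable_bottomError_eval (T := T) ε.coe_nonneg).ennreal_ofReal
  have hprod (ε : ℝ≥0) : ∫⁻ ω, pathError φ μ ε ω ∂Q = ∫⁻ p,
      ENNReal.ofReal (bottomError (φ (p.1.1 p.2)) ε (p.1.2 p.2)) ∂(Q.prod μ) :=
    (lintegral_prod _ (herror ε).aemeasurable).symm
  simp only [hprod]
  rw [← lintegral_zero (μ := Q.prod μ)]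
  refine tendsto_lintegral_filter_of_dominated_convergence
    (fun p => ENNReal.ofReal (3 * (M + 1) * Real.exp (M + 1)) *
      (ENNReal.ofReal (φ (p.1.1 p.2) (p.1.2 p.2)) + ENNReal.ofReal (Φ (p.1.1 p.2)) + 1))
    (.of_forall herror) ?_ ?_ (.of_forall fun p => ?_)
  · have hε1 : ∀ᶠ ε : ℝ≥0 in 𝓝[>] 0, ε ≤ 1 :=
      nhdsWithin_le_nhds (Iic_mem_nhds zero_lt_one)
    filter_upwards [hε1] with ε hε
    refine .of_forall fun p => ?_
    have hM := hΦ.const_nonneg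
    have hφ0 := hφ.nonneg (p.1.1 p.2) _ (p.1.2.eval_nonneg p.2)
    rw [← ENNReal.ofReal_add hφ0 (hΦ.nonneg _), ← ENNReal.ofReal_one,
      ← ENNReal.ofReal_add (add_nonneg hφ0 (hΦ.nonneg _)) zero_le_one,
      ← ENNReal.ofReal_mul (by positivity)]
    exact ENNReal.ofReal_le_ofReal
      (hΦ.bottomError_le hφ _ (p.1.2.eval_nonneg p.2) ⟨ε.coe_nonneg, by exact_mod_cast hε⟩)
  · rw [lintegral_const_mul' _ _ ENNReal.ofReal_ne_top]
    exact (ENNReal.mul_lt_top ENNReal.ofReal_lt_top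
      (hΦ.lintegral_prod_lt_top hφ hcost hQ)).ne
  · have hcoe : Tendsto ((↑) : ℝ≥0 → ℝ) (𝓝[>] 0) (𝓝[>] 0) :=
      tendsto_nhdsWithin_iff.2 ⟨NNReal.continuous_coe.continuousAt.continuousWithinAt,
        eventually_mem_nhdsWithin⟩
    rw [← ENNReal.ofReal_zero]
    exact ENNReal.tendsto_ofReal
      ((tendsto_bottomError (hφ.contDiffOn _) (p.1.2.eval_nonneg p.2)).comp hcoe)

end Integrability

section StoppingValue

variable {d : ℕ} {T : ℝ}

namespace CostIngredients

/-- The function `f` of the cost, extended by zero outside `[0,T]`. -/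
def timeCost (c : CostIngredients d T) : ℝ → ℝ :=
  (Icc 0 T).indicator c.f

variable {c : CostIngredients d T}

theorem isConvexCost_h (hh : ∀ l, ContDiffOn ℝ 1 (c.h l) (Ici 0)) : IsConvexCost c.h :=
  ⟨c.h_nonneg, c.h_meas, c.h_convex, hh⟩

theorem isConvexCost_g (hg : ∀ l, ContDiffOn ℝ 1 (c.g l) (Ici 0)) : IsConvexCost c.g :=
  ⟨c.g_nonneg, c.g_meas, c.g_convex, hg⟩

theorem timeCost_nonneg (t : ℝ) : 0 ≤ c.timeCost t :=
  indicator_nonneg c.f_nonneg t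

theorem timeCost_of_lt {t : ℝ} (ht : T < t) : c.timeCost t = 0 :=
  indicator_of_notMem (fun h => h.2.not_gt ht) _

theorem continuousOn_timeCost : ContinuousOn c.timeCost (Icc 0 T) :=
  c.f_cont.congr fun _ ht => indicator_of_mem ht _

theorem measurable_timeCost : Measurable c.timeCost := by
  classical
  rw [timeCost, ← piecewise_eq_indicator]
  exact c.f_cont.measurable_piecewise continuousOn_const measurableSet_Icc

theorem exists_timeCost_le [hT : Fact (0 < T)] (c : CostIngredients d T) :
    ∃ C, ∀ t, c.timeCost t ≤ C := by
  obtain ⟨C, hC⟩ := isCompact_Icc.exists_bound_of_continuousOn c.f_cont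
  have hC0 : 0 ≤ C := (norm_nonneg _).trans (hC 0 ⟨le_rfl, hT.out.le⟩)
  exact ⟨C, fun t => indicator_le'
    (fun t ht => (le_abs_self _).trans (hC t ht)) (fun _ _ => hC0) t⟩

variable [hT : Fact (0 < T)]

/-- The cost of starting to act at time `s`, for the target `L`; it vanishes for `T < s`. -/
def stopValue (c : CostIngredients d T) (L : CadlagPath T (EuclideanSpace ℝ (Fin d))) (s : ℝ) : ℝ :=
  c.timeCost s + (marginalCost c.h (volume.restrict (Icc 0 T)) L s
    + marginalCost c.g (Measure.dirac T) L s)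

/-- The error of the first-order expansion of `cost`, per unit of `ε`. -/
def replaceError (c : CostIngredients d T) (ε : ℝ≥0) (ω : PathPair d T) : ℝ≥0∞ :=
  controlError (fun t => ENNReal.ofReal (c.timeCost t)) ε ω.2
    + (pathError c.h (volume.restrict (Icc 0 T)) ε ω + pathError c.g (Measure.dirac T) ε ω)

theorem cost_eq (c : CostIngredients d T) (ω : PathPair d T) :
    c.cost ω = controlCost (fun t => ENNReal.ofReal (c.timeCost t)) ω.2
      + (pathCost c.h (volume.restrict (Icc 0 T)) ω + pathCost c.g (Measure.dirac T) ω) := by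
  have hcontrol : (fun t => ENNReal.ofReal (c.timeCost t))
      = (Icc 0 T).indicator fun t => ENNReal.ofReal (c.f t) :=
    (indicator_comp_of_zero ENNReal.ofReal_zero).symm
  rw [cost, add_assoc, controlCost, hcontrol, lintegral_indicator measurableSet_Icc, pathCost,
    pathCost, lintegral_dirac]

theorem stoppingCost_eq (c : CostIngredients d T) (ω : PathPair d T) :
    c.stoppingCost ω = c.stopValue ω.1 (startTime ω.2) := by
  by_cases hτ : startTime ω.2 ≤ T
  · have hIcc : Ici (startTime ω.2) ∩ Icc 0 T = Icc (startTime ω.2) T :=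
      Subset.antisymm (fun _ h => ⟨h.1, h.2.2⟩) fun _ h =>
        ⟨h.1, (startTime_nonneg ω.2).trans h.1, h.2⟩
    rw [stoppingCost, if_neg (fun h => firstPositive_eq_top_iff.1 h hτ),
      firstPositive_eq_startTime hτ, EReal.toReal_coe, stopValue, timeCost,
      indicator_of_mem (mem_Icc.2 ⟨startTime_nonneg _, hτ⟩), marginalCost, marginalCost,
      Measure.restrict_restrict measurableSet_Ici, hIcc, integral_Icc_eq_integral_Ioc,
      ← intervalIntegral.integral_of_le hτ, setIntegral_dirac, if_pos (mem_Ici.2 hτ)]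
    ring
  · have hlt : T < startTime ω.2 := not_le.1 hτ
    have hempty : Ici (startTime ω.2) ∩ Icc 0 T = ∅ :=
      eq_empty_of_forall_notMem fun t h => hτ ((mem_Ici.1 h.1).trans h.2.2)
    rw [stoppingCost, if_pos (firstPositive_eq_top_iff.2 hτ), stopValue, timeCost_of_lt hlt,
      marginalCost, marginalCost, Measure.restrict_restrict measurableSet_Ici, hempty,
      Measure.restrict_empty, integral_zero_measure, setIntegral_dirac,
      if_neg (notMem_Ici.2 hlt), add_zero, add_zero]

theorem measurable_stopValue (hh : IsConvexCost c.h) (hg : IsConvexCost c.g) :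
    Measurable fun p : CadlagPath T (EuclideanSpace ℝ (Fin d)) × ℝ => c.stopValue p.1 p.2 :=
  (c.measurable_timeCost.comp measurable_snd).add
    ((measurable_marginalCost hh).add (measurable_marginalCost hg))

theorem measurable_stoppingCost (hh : IsConvexCost c.h) (hg : IsConvexCost c.g) :
    Measurable c.stoppingCost := by
  rw [funext c.stoppingCost_eq]
  exact (measurable_stopValue hh hg).comp (measurable_fst.prodMk measurable_startTime_snd)

theorem measurable_cost (hh : IsConvexCost c.h) (hg : IsConvexCost c.g) : Measurable c.cost := by
  rw [funext c.cost_eq]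
  exact ((measurable_controlCost c.measurable_timeCost.ennreal_ofReal).comp measurable_snd).add
    ((measurable_pathCost hh).add (measurable_pathCost hg))

theorem measurable_replaceError (hh : IsConvexCost c.h) (hg : IsConvexCost c.g) (ε : ℝ≥0) :
    Measurable (c.replaceError ε) :=
  (measurable_controlError_snd c.measurable_timeCost.ennreal_ofReal ε).add
    ((measurable_pathError hh ε.coe_nonneg).add (measurable_pathError hg ε.coe_nonneg))

theorem cost_replaceBottom_add_le (hh : IsConvexCost c.h) (hg : IsConvexCost c.g)
    (ω : PathPair d T) {ε : ℝ≥0} (hε : 0 < ε) {s : ℝ} (hs : 0 ≤ s)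
    (hD : IntegrableOn (fun t => derivA c.h (ω.1 t) 0) (Icc 0 T)) :
    c.cost (ω.1, ω.2.replaceBottom ε s)
        + ε * (ENNReal.ofReal (c.stoppingCost ω) + ENNReal.ofReal (-c.stopValue ω.1 s))
      ≤ c.cost ω + ε * (c.replaceError ε ω
        + (ENNReal.ofReal (c.stopValue ω.1 s) + ENNReal.ofReal (-c.stoppingCost ω))) := by
  suffices hexpand : (c.cost (ω.1, ω.2.replaceBottom ε s) : EReal)
      ≤ (c.cost ω + ε * c.replaceError ε ω : ℝ≥0∞)
        + ((ε * c.stopValue ω.1 s - ε * c.stoppingCost ω : ℝ) : EReal) by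
    rw [coe_le_coe_add_sub_iff, ← mul_neg, ← mul_neg] at hexpand
    simpa only [ENNReal.ofReal_mul ε.coe_nonneg, ENNReal.ofReal_coe_nnreal, mul_add, add_assoc]
      using hexpand
  have hcontrol : (controlCost (fun t => ENNReal.ofReal (c.timeCost t))
        (ω.2.replaceBottom ε s) : EReal)
      ≤ (controlCost (fun t => ENNReal.ofReal (c.timeCost t)) ω.2
          + ε * controlError (fun t => ENNReal.ofReal (c.timeCost t)) ε ω.2 : ℝ≥0∞)
        + ((ε * c.timeCost s - ε * c.timeCost (startTime ω.2) : ℝ) : EReal) := by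
    rw [coe_le_coe_add_sub_iff, ← mul_neg, ← mul_neg]
    simpa only [ENNReal.ofReal_mul ε.coe_nonneg, ENNReal.ofReal_coe_nnreal,
      ENNReal.ofReal_of_nonpos (neg_nonpos.2 (c.timeCost_nonneg _)), mul_zero, add_zero]
      using controlCost_replaceBottom_add_le c.measurable_timeCost.ennreal_ofReal
        (fun t ht => by rw [timeCost_of_lt ht, ENNReal.ofReal_zero]) ω.2 hε hs
  have hsum := add_le_add hcontrol (add_le_add
    (pathCost_replaceBottom_le hh isTimeWeight_volume ω.1 ω.2 ε s hD)
    (pathCost_replaceBottom_le hg isTimeWeight_dirac ω.1 ω.2 ε s (integrable_dirac (by simp))))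
  rw [add_add_add_comm (pathCost _ _ _ + _ : ℝ≥0∞).toEReal, add_add_add_comm] at hsum
  simp only [← EReal.coe_ennreal_add, ← EReal.coe_add] at hsum
  rw [cost_eq, cost_eq, stoppingCost_eq]
  convert hsum using 3
  · rw [replaceError]
    ring
  · simp only [stopValue]
    ring

theorem ofReal_stopValue_le {C : ℝ} (hC : ∀ t, c.timeCost t ≤ C)
    (L : CadlagPath T (EuclideanSpace ℝ (Fin d))) (s : ℝ) :
    ENNReal.ofReal (c.stopValue L s) ≤ ENNReal.ofReal C
      + ((∫⁻ t in Icc 0 T, ENNReal.ofReal (derivA c.h (L t) 0))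
        + ∫⁻ t, ENNReal.ofReal (derivA c.g (L t) 0) ∂Measure.dirac T) :=
  ENNReal.ofReal_add_le.trans <| add_le_add (ENNReal.ofReal_le_ofReal (hC s)) <|
    ENNReal.ofReal_add_le.trans <|
      add_le_add (ofReal_marginalCost_le L s) (ofReal_marginalCost_le L s)

end CostIngredients

end StoppingValue

section Comparison

theorem lintegral_fst_gluing {d : ℕ} {T : ℝ} [hT : Fact (0 < T)] {P P' : Measure (PathPair d T)}
    [IsProbabilityMeasure P] [IsProbabilityMeasure P'] {F : PathPair d T → ℝ≥0∞}
    (hF : Measurable F) : ∫⁻ p, F p.1 ∂gluing P P' = ∫⁻ ω, F ω ∂P := by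
  rw [← lintegral_map hF measurable_fst, map_fst_gluing]

variable {d : ℕ} {T : ℝ} [hT : Fact (0 < T)]
  {P₀ : Measure (CadlagPath T (EuclideanSpace ℝ (Fin d)))} {P P' : Measure (PathPair d T)}

theorem lintegral_target_gluing [IsProbabilityMeasure P] [IsProbabilityMeasure P']
    (h : P.map Prod.fst = P'.map Prod.fst)
    {F : CadlagPath T (EuclideanSpace ℝ (Fin d)) × ℝ → ℝ≥0∞} (hF : Measurable F) :
    ∫⁻ p, F (p.1.1, p.2) ∂gluing P P' = ∫⁻ ω, F (ω.1, startTime ω.2) ∂P' := by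
  rw [← lintegral_map hF (measurable_fst.fst.prodMk measurable_snd), map_target_gluing h,
    lintegral_map hF (measurable_fst.prodMk measurable_startTime_snd)]

theorem ae_nonneg_snd_gluing [IsProbabilityMeasure P] [IsProbabilityMeasure P']
    (h : P.map Prod.fst = P'.map Prod.fst) : ∀ᵐ p ∂gluing P P', 0 ≤ p.2 := by
  refine ae_of_ae_map (p := fun q : CadlagPath T (EuclideanSpace ℝ (Fin d)) × ℝ => 0 ≤ q.2)
    (measurable_fst.fst.prodMk measurable_snd).aemeasurable ?_
  rw [map_target_gluing h, ae_map_iff (measurable_fst.prodMk measurable_startTime_snd).aemeasurable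
    (measurableSet_le measurable_const measurable_snd)]
  exact .of_forall fun ω => startTime_nonneg ω.2

namespace CostIngredients

/-- The standing assumptions of the theorem on the costs `g` and `h`, for a target of law `P₀`. -/
structure IsRegular (c : CostIngredients d T)
    (P₀ : Measure (CadlagPath T (EuclideanSpace ℝ (Fin d))))
    (Φg Φh : EuclideanSpace ℝ (Fin d) → ℝ) (M : ℝ) : Prop where
  convex_h : IsConvexCost c.h
  convex_g : IsConvexCost c.g
  growth_h : HasGrowthBound c.h Φh M
  growth_g : HasGrowthBound c.g Φg M
  lintegral_h_lt_top : ∫⁻ L, (∫⁻ t in Icc 0 T, ENNReal.ofReal (Φh (L t))) ∂P₀ < ∞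
  lintegral_g_lt_top : ∫⁻ L, (∫⁻ t, ENNReal.ofReal (Φg (L t)) ∂Measure.dirac T) ∂P₀ < ∞

variable {c : CostIngredients d T} {Φg Φh : EuclideanSpace ℝ (Fin d) → ℝ} {M : ℝ}

theorem lintegral_pathCost_h_lt_top (hJ : c.J P < ∞) :
    ∫⁻ ω, pathCost c.h (volume.restrict (Icc 0 T)) ω ∂P < ∞ :=
  (lintegral_mono fun ω => by rw [cost_eq]; exact le_add_left le_self_add).trans_lt hJ

theorem lintegral_pathCost_g_lt_top (hJ : c.J P < ∞) :
    ∫⁻ ω, pathCost c.g (Measure.dirac T) ω ∂P < ∞ :=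
  (lintegral_mono fun ω => by rw [cost_eq]; exact le_add_left le_add_self).trans_lt hJ

theorem tendsto_lintegral_controlError [IsFiniteMeasure P] (c : CostIngredients d T) :
    Tendsto (fun ε : ℝ≥0 => ∫⁻ ω, controlError (fun t => ENNReal.ofReal (c.timeCost t)) ε ω.2 ∂P)
      (𝓝[>] 0) (𝓝 0) := by
  obtain ⟨C, hC⟩ := c.exists_timeCost_le
  rw [← lintegral_zero (μ := P)]
  refine tendsto_lintegral_filter_of_dominated_convergence (fun _ => ENNReal.ofReal C)
    (.of_forall fun ε => measurable_controlError_snd c.measurable_timeCost.ennreal_ofReal ε)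
    (.of_forall fun ε => .of_forall fun ω =>
      (controlError_le _ ε ω.2).trans (ENNReal.ofReal_le_ofReal (hC _))) ?_
    (.of_forall fun ω => tendsto_controlError
      (ENNReal.continuous_ofReal.comp_continuousOn' c.continuousOn_timeCost)
      (fun t ht => by rw [timeCost_of_lt ht, ENNReal.ofReal_zero])
      (fun t => ENNReal.ofReal_ne_top) ω.2)
  rw [lintegral_const]
  exact ENNReal.mul_ne_top ENNReal.ofReal_ne_top (measure_ne_top _ _)

theorem lintegral_stopValue_gluing [IsProbabilityMeasure P] [IsProbabilityMeasure P']
    (hh : IsConvexCost c.h) (hg : IsConvexCost c.g) (h : P.map Prod.fst = P'.map Prod.fst)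
    {φ : ℝ → ℝ≥0∞} (hφ : Measurable φ) :
    ∫⁻ p, φ (c.stopValue p.1.1 p.2) ∂gluing P P' = ∫⁻ ω, φ (c.stoppingCost ω) ∂P' := by
  simp only [stoppingCost_eq]
  exact lintegral_target_gluing h (hφ.comp (measurable_stopValue hh hg))

theorem J_map_replaceMap_gluing_add_le [IsProbabilityMeasure P] [IsProbabilityMeasure P']
    (hh : IsConvexCost c.h) (hg : IsConvexCost c.g) (h : P.map Prod.fst = P'.map Prod.fst)
    (hD : ∀ᵐ ω ∂P, IntegrableOn (fun t => derivA c.h (ω.1 t) 0) (Icc 0 T)) {ε : ℝ≥0}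
    (hε : 0 < ε) :
    c.J ((gluing P P').map (replaceMap ε))
        + ε * (∫⁻ ω, ENNReal.ofReal (c.stoppingCost ω) ∂P
          + ∫⁻ ω, ENNReal.ofReal (-c.stoppingCost ω) ∂P')
      ≤ c.J P + ε * (∫⁻ ω, c.replaceError ε ω ∂P
        + (∫⁻ ω, ENNReal.ofReal (c.stoppingCost ω) ∂P'
          + ∫⁻ ω, ENNReal.ofReal (-c.stoppingCost ω) ∂P)) := by
  have hcost := measurable_cost hh hg
  have herror := measurable_replaceError hh hg ε
  have hZpos := (measurable_stoppingCost hh hg).ennreal_ofReal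
  have hZneg : Measurable fun ω => ENNReal.ofReal (-c.stoppingCost ω) :=
    (measurable_stoppingCost hh hg).neg.ennreal_ofReal
  have hZpos' : Measurable fun p : PathPair d T × ℝ => ENNReal.ofReal (c.stoppingCost p.1) :=
    hZpos.comp measurable_fst
  have hSpos : Measurable fun p : PathPair d T × ℝ => ENNReal.ofReal (c.stopValue p.1.1 p.2) :=
    ((measurable_stopValue hh hg).comp
      (measurable_fst.fst.prodMk measurable_snd)).ennreal_ofReal
  have herror' : Measurable fun p : PathPair d T × ℝ => c.replaceError ε p.1 :=
    herror.comp measurable_fst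
  have hcost' : Measurable fun p : PathPair d T × ℝ => c.cost p.1 := hcost.comp measurable_fst
  have hcostR : Measurable fun p : PathPair d T × ℝ => c.cost (replaceMap ε p) :=
    hcost.comp (measurable_replaceMap ε)
  have hfst {F : PathPair d T → ℝ≥0∞} (hF : Measurable F) :
      ∫⁻ ω, F ω ∂P = ∫⁻ p, F p.1 ∂gluing P P' := (lintegral_fst_gluing hF).symm
  rw [← lintegral_stopValue_gluing hh hg h ENNReal.measurable_ofReal,
    ← lintegral_stopValue_gluing hh hg h (φ := fun x => ENNReal.ofReal (-x)) (by fun_prop),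
    J, J, lintegral_map hcost (measurable_replaceMap ε), hfst hZpos, hfst hZneg, hfst herror,
    hfst hcost, ← lintegral_add_left hZpos', ← lintegral_add_left hSpos,
    ← lintegral_add_left herror', ← lintegral_const_mul' _ _ ENNReal.coe_ne_top,
    ← lintegral_const_mul' _ _ ENNReal.coe_ne_top, ← lintegral_add_left hcostR,
    ← lintegral_add_left hcost']
  refine lintegral_mono_ae ?_
  have hD' : ∀ᵐ p ∂gluing P P', IntegrableOn (fun t => derivA c.h (p.1.1 t) 0) (Icc 0 T) :=
    ae_of_ae_map measurable_fst.aemeasurable ((map_fst_gluing (P := P) (P' := P')).symm ▸ hD)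
  filter_upwards [ae_nonneg_snd_gluing h, hD'] with p hp hDp
  exact cost_replaceBottom_add_le hh hg p.1 hε hp hDp

namespace IsRegular

theorem ae_integrableOn_derivA (hc : c.IsRegular P₀ Φg Φh M) (hP : P.map Prod.fst = P₀)
    (hJ : c.J P < ∞) : ∀ᵐ L ∂P₀, IntegrableOn (fun t => derivA c.h (L t) 0) (Icc 0 T) := by
  subst hP
  exact hc.growth_h.ae_integrable_derivA_zero hc.convex_h (lintegral_pathCost_h_lt_top hJ)
    hc.lintegral_h_lt_top

theorem lintegral_ofReal_stoppingCost_lt_top [IsFiniteMeasure P']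
    (hc : c.IsRegular P₀ Φg Φh M) (hP : P.map Prod.fst = P₀) (hJ : c.J P < ∞)
    (hP' : P'.map Prod.fst = P₀) : ∫⁻ ω, ENNReal.ofReal (c.stoppingCost ω) ∂P' < ∞ := by
  obtain ⟨C, hC⟩ := c.exists_timeCost_le
  have hDh := hc.convex_h.measurable_lintegral_ofReal_derivA_zero (T := T)
    (μ := volume.restrict (Icc 0 T))
  have hDg := hc.convex_g.measurable_lintegral_ofReal_derivA_zero (T := T) (μ := Measure.dirac T)
  have hlaw : ∫⁻ ω, ((∫⁻ t in Icc 0 T, ENNReal.ofReal (derivA c.h (ω.1 t) 0))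
        + ∫⁻ t, ENNReal.ofReal (derivA c.g (ω.1 t) 0) ∂Measure.dirac T) ∂P'
      = (∫⁻ L, (∫⁻ t in Icc 0 T, ENNReal.ofReal (derivA c.h (L t) 0)) ∂P₀)
        + ∫⁻ L, (∫⁻ t, ENNReal.ofReal (derivA c.g (L t) 0) ∂Measure.dirac T) ∂P₀ := by
    rw [← lintegral_add_left hDh, ← hP']
    exact (lintegral_map (hDh.add hDg) measurable_fst).symm
  refine (lintegral_mono fun ω => (c.stoppingCost_eq ω).symm ▸
    ofReal_stopValue_le hC ω.1 (startTime ω.2)).trans_lt ?_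
  rw [lintegral_add_left measurable_const, lintegral_const, hlaw]
  subst hP
  exact ENNReal.add_lt_top.2 ⟨ENNReal.mul_lt_top ENNReal.ofReal_lt_top (measure_lt_top _ _),
    ENNReal.add_lt_top.2 ⟨hc.growth_h.lintegral_lintegral_ofReal_derivA_zero_lt_top hc.convex_h
        (lintegral_pathCost_h_lt_top hJ) hc.lintegral_h_lt_top,
      hc.growth_g.lintegral_lintegral_ofReal_derivA_zero_lt_top hc.convex_g
        (lintegral_pathCost_g_lt_top hJ) hc.lintegral_g_lt_top⟩⟩

theorem tendsto_lintegral_replaceError [IsFiniteMeasure P] (hc : c.IsRegular P₀ Φg Φh M)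
    (hP : P.map Prod.fst = P₀) (hJ : c.J P < ∞) :
    Tendsto (fun ε => ∫⁻ ω, c.replaceError ε ω ∂P) (𝓝[>] 0) (𝓝 0) := by
  subst hP
  have hsplit (ε : ℝ≥0) : ∫⁻ ω, c.replaceError ε ω ∂P
      = ∫⁻ ω, controlError (fun t => ENNReal.ofReal (c.timeCost t)) ε ω.2 ∂P
        + (∫⁻ ω, pathError c.h (volume.restrict (Icc 0 T)) ε ω ∂P
          + ∫⁻ ω, pathError c.g (Measure.dirac T) ε ω ∂P) := by
    simp only [replaceError]
    rw [lintegral_add_left (measurable_controlError_snd c.measurable_timeCost.ennreal_ofReal ε),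
      lintegral_add_left (measurable_pathError hc.convex_h ε.coe_nonneg)]
  simpa only [hsplit, add_zero] using (tendsto_lintegral_controlError c).add
    ((hc.growth_h.tendsto_lintegral_pathError hc.convex_h (lintegral_pathCost_h_lt_top hJ)
        hc.lintegral_h_lt_top).add
      (hc.growth_g.tendsto_lintegral_pathError hc.convex_g (lintegral_pathCost_g_lt_top hJ)
        hc.lintegral_g_lt_top))

theorem lintegral_stoppingCost_add_le_add_replaceError [IsProbabilityMeasure P₀]
    (hc : c.IsRegular P₀ Φg Φh M) (hP : IsFollowerSolution P₀ c P) (hP' : Admissible P₀ P')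
    {ε : ℝ≥0} (hε : 0 < ε) :
    ∫⁻ ω, ENNReal.ofReal (c.stoppingCost ω) ∂P + ∫⁻ ω, ENNReal.ofReal (-c.stoppingCost ω) ∂P'
      ≤ ∫⁻ ω, c.replaceError ε ω ∂P + (∫⁻ ω, ENNReal.ofReal (c.stoppingCost ω) ∂P'
        + ∫⁻ ω, ENNReal.ofReal (-c.stoppingCost ω) ∂P) := by
  have := hP.1.isProbabilityMeasure
  have := hP'.isProbabilityMeasure
  have hopt : c.J P ≤ c.J ((gluing P P').map (replaceMap ε)) :=
    hP.2.2.trans_le (iInf₂_le _ (admissible_map_replaceMap_gluing hP.1 hP' ε))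
  have hD : ∀ᵐ ω ∂P, IntegrableOn (fun t => derivA c.h (ω.1 t) 0) (Icc 0 T) :=
    ae_of_ae_map measurable_fst.aemeasurable
      (hP.1.marginal.symm ▸ hc.ae_integrableOn_derivA hP.1.marginal hP.2.1)
  have hexpand := (add_le_add_left hopt _).trans (J_map_replaceMap_gluing_add_le hc.convex_h
    hc.convex_g (hP.1.marginal.trans hP'.marginal.symm) hD hε)
  exact (ENNReal.mul_le_mul_iff_right (by exact_mod_cast hε.ne') ENNReal.coe_ne_top).1
    ((ENNReal.add_le_add_iff_left hP.2.1.ne).1 hexpand)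

theorem lintegral_stoppingCost_add_le [IsProbabilityMeasure P₀]
    (hc : c.IsRegular P₀ Φg Φh M) (hP : IsFollowerSolution P₀ c P) (hP' : Admissible P₀ P') :
    ∫⁻ ω, ENNReal.ofReal (c.stoppingCost ω) ∂P + ∫⁻ ω, ENNReal.ofReal (-c.stoppingCost ω) ∂P'
      ≤ ∫⁻ ω, ENNReal.ofReal (c.stoppingCost ω) ∂P'
        + ∫⁻ ω, ENNReal.ofReal (-c.stoppingCost ω) ∂P := by
  have := hP.1.isProbabilityMeasure
  have hlim := (hc.tendsto_lintegral_replaceError hP.1.marginal hP.2.1).add_const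
    (∫⁻ ω, ENNReal.ofReal (c.stoppingCost ω) ∂P' + ∫⁻ ω, ENNReal.ofReal (-c.stoppingCost ω) ∂P)
  rw [zero_add] at hlim
  refine ge_of_tendsto hlim ?_
  filter_upwards [self_mem_nhdsWithin] with ε hε
  exact hc.lintegral_stoppingCost_add_le_add_replaceError hP hP' hε

end IsRegular

end CostIngredients

theorem coe_sub_coe_le_coe_sub_coe {a b a' b' : ℝ≥0∞} (ha : a ≠ ∞) (ha' : a' ≠ ∞)
    (h : a + b' ≤ a' + b) : (a : EReal) - b ≤ (a' : EReal) - b' := by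
  rcases eq_or_ne b ∞ with rfl | hb
  · simp
  have hb' : b' ≠ ∞ := ne_top_of_le_ne_top (ENNReal.add_ne_top.2 ⟨ha', hb⟩) (le_add_self.trans h)
  lift a to ℝ≥0 using ha
  lift a' to ℝ≥0 using ha'
  lift b to ℝ≥0 using hb
  lift b' to ℝ≥0 using hb'
  rw [← ENNReal.coe_add, ← ENNReal.coe_add, ENNReal.coe_le_coe, ← NNReal.coe_le_coe,
    NNReal.coe_add, NNReal.coe_add] at h
  change ((a - b : ℝ) : EReal) ≤ ((a' - b' : ℝ) : EReal)
  exact EReal.coe_le_coe_iff.2 (by linarith)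

theorem CostIngredients.extendedK_eq_coe_K {c : CostIngredients d T}
    (hZ : Integrable c.stoppingCost P) : c.extendedK P = (c.K P : EReal) := by
  have hneg : ∫⁻ ω, ENNReal.ofReal (-c.stoppingCost ω) ∂P ≠ ∞ := hZ.neg.lintegral_lt_top.ne
  rw [K, integral_eq_lintegral_pos_part_sub_lintegral_neg_part hZ, EReal.coe_sub,
    EReal.coe_ennreal_toReal hZ.lintegral_lt_top.ne, EReal.coe_ennreal_toReal hneg]
  rfl

end Comparison

end MonotoneFollower

end

open MonotoneFollower CostIngredients

theorem theorem2p14 {d : ℕ} {T : ℝ} [Fact (0 < T)]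
    (P₀ : Measure (MonotoneFollower.CadlagPath T (EuclideanSpace ℝ (Fin d))))
    [IsProbabilityMeasure P₀]
    (c : MonotoneFollower.CostIngredients d T)
    (hg : ∀ l, ContDiffOn ℝ 1 (c.g l) (Ici 0))
    (hh : ∀ l, ContDiffOn ℝ 1 (c.h l) (Ici 0))
    (Φg Φh : EuclideanSpace ℝ (Fin d) → ℝ) (M : ℝ)
    (hΦg : Measurable Φg) (hΦh : Measurable Φh)
    (hΦg0 : ∀ l, 0 ≤ Φg l) (hΦh0 : ∀ l, 0 ≤ Φh l) (hM : 0 ≤ M)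
    (hΦ : ∫⁻ L, ((∫⁻ t in Icc 0 T, ENNReal.ofReal (Φh (L t))) + ENNReal.ofReal (Φg (L T))) ∂P₀ < ∞)
    (hgrowth_g : ∀ l, ∀ a, 0 ≤ a → |MonotoneFollower.derivA c.g l a| ≤ Φg l + M * c.g l a)
    (hgrowth_h : ∀ l, ∀ a, 0 ≤ a → |MonotoneFollower.derivA c.h l a| ≤ Φh l + M * c.h l a)
    (P : Measure (MonotoneFollower.PathPair d T))
    (hP : MonotoneFollower.IsFollowerSolution P₀ c P) :
    -- the stopping objective is well defined in `[-∞,∞)` for every admissible control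
    (∀ᵐ L ∂P₀, IntervalIntegrable (fun t => MonotoneFollower.derivA c.h (L t) 0) volume 0 T) ∧
    (∀ P', MonotoneFollower.Admissible P₀ P' →
      AEMeasurable c.stoppingCost P' ∧ ∫⁻ ω, ENNReal.ofReal (c.stoppingCost ω) ∂P' < ∞) ∧
    -- `P` minimizes it over all admissible controls
    (∀ P', MonotoneFollower.Admissible P₀ P' → c.extendedK P ≤ c.extendedK P') ∧
    -- `P` solves the optimal-stopping problem over `𝒜_S` as soon as it belongs to `𝒜_S`
    (MonotoneFollower.StoppingAdmissible P₀ c P → MonotoneFollower.IsStoppingSolution P₀ c P) := by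
  have hc : c.IsRegular P₀ Φg Φh M :=
    { convex_h := isConvexCost_h hh
      convex_g := isConvexCost_g hg
      growth_h := ⟨hΦh, hΦh0, hM, hgrowth_h⟩
      growth_g := ⟨hΦg, hΦg0, hM, hgrowth_g⟩
      lintegral_h_lt_top := (lintegral_mono fun _ => le_self_add).trans_lt hΦ
      lintegral_g_lt_top := by
        simp only [lintegral_dirac]
        exact (lintegral_mono fun _ => le_add_self).trans_lt hΦ }
  have hpos (P') (hP' : Admissible P₀ P') :
      ∫⁻ ω, ENNReal.ofReal (c.stoppingCost ω) ∂P' < ∞ :=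
    have := hP'.isProbabilityMeasure
    hc.lintegral_ofReal_stoppingCost_lt_top hP.1.marginal hP.2.1 hP'.marginal
  have hmin (P') (hP' : Admissible P₀ P') : c.extendedK P ≤ c.extendedK P' :=
    coe_sub_coe_le_coe_sub_coe (hpos P hP.1).ne (hpos P' hP').ne
      (hc.lintegral_stoppingCost_add_le hP hP')
  refine ⟨?_, fun P' hP' =>
    ⟨(measurable_stoppingCost hc.convex_h hc.convex_g).aemeasurable, hpos P' hP'⟩,
    hmin, fun hS => ⟨hS, fun P' hP' => ?_⟩⟩
  · filter_upwards [hc.ae_integrableOn_derivA hP.1.marginal hP.2.1] with L hL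
    exact (intervalIntegrable_iff_integrableOn_Icc_of_le (Fact.out : 0 < T).le).2 hL
  · rw [← EReal.coe_le_coe_iff, ← extendedK_eq_coe_K hS.2.2, ← extendedK_eq_coe_K hP'.2.2]
    exact hmin P' hP'.1
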